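/- **Theorem.** Let $G$ and $H$ be locally compact (Hausdorff) groups with left Haar measures and modular functions $\Delta_G,\Delta_H$ (so $m(As)=\Delta(s)m(A)$). Let $\tau_1$ be the isometric conjugation action on $L^1(G)$, $\tau_1(s)f(x)=\Delta_G(s)f(s^{-1}xs)$. Suppose that $G$ is a QSIN group, that is, the convolution algebra $L^1(G)$ has a bounded (two-sided) approximate identity $(e_\alpha)$ such that $\|\tau_1(s)e_\alpha-e_\alpha\|_1\to 0$ uniformly for $s$ in compact subsets of $G$. Let $\iota\colon H\to G$ be a continuous injective group homomorphism. For a locally compact group $K$, let $\lambda_K\cdot\rho_K$ denote the unitary representation of $K\times K$ on $L^2(K)$ given by $$\big((\lambda_K\cdot\rho_K)(s,t)f\big)(x)=\Delta_K(t)^{1/2}f(s^{-1}xt).$$ Then the representation $\lambda_H\cdot\rho_H$ of $H\times H$ is weakly contained in $(\lambda_G\cdot\rho_G)\circ(\iota\times\iota)$. That is, for every $f\in L^2(H)$, every compact $Q\subset H\times H$ and every $\varepsilon>0$ there are finitely many $f_1,\dots,f_n\in L^2(G)$ such that $$\Big|\big\langle(\lambda_H\cdot\rho_H)(s,t)f,f\big\rangle-\sum_{i=1}^n\big\langle(\lambda_G\cdot\rho_G)(\iota(s),\iota(t))f_i,f_i\big\rangle\Big|<\varepsilon\qquad\text{for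 all }(s,t)\in Q.$$ -/

import Mathlib

open MeasureTheory Filter Topology
open scoped ENNReal NNReal

universe u

noncomputable section

/-! ### Unitary representations and weak containment -/

/-- A unitary representation of a topological group `G` on an inner product space `V`: a
homomorphism into the unitary operators of `V`, continuous for the strong operator topology. -/
structure UnitaryRep (G : Type*) [Group G] [TopologicalSpace G]
    (V : Type*) [NormedAddCommGroup V] [InnerProductSpace ℂ V] where
  toHom : G →* (V ≃ₗᵢ[ℂ] V)
  continuous_apply : ∀ v : V, Continuous fun g : G => toHom g v

namespace UnitaryRep

/-- The coefficient function `s ↦ ⟨π(s)ξ, η⟩`. The mathematical inner product is linear in its first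
variable, Mathlib's `inner` in its second one. -/
def coeff {G : Type*} [Group G] [TopologicalSpace G] {V : Type*} [NormedAddCommGroup V]
    [InnerProductSpace ℂ V] (π : UnitaryRep G V) (ξ η : V) (s : G) : ℂ :=
  inner ℂ η (π.toHom s ξ)

/-- The composition of a representation of `G` with a continuous homomorphism `H → G`. -/
def comp {G H : Type*} [Group G] [TopologicalSpace G] [Group H] [TopologicalSpace H]
    {V : Type*} [NormedAddCommGroup V] [InnerProductSpace ℂ V] (π : UnitaryRep G V)
    (φ : H →ₜ* G) : UnitaryRep H V where
  toHom := π.toHom.comp φ.toMonoidHom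
  continuous_apply v := (π.continuous_apply v).comp φ.continuous_toFun

/-- `π` is weakly contained in `σ`: every diagonal coefficient function of `π` is, uniformly on
compact sets, a limit of finite sums of diagonal coefficient functions of `σ`. -/
def WeaklyContained {G : Type*} [Group G] [TopologicalSpace G]
    {V : Type*} [NormedAddCommGroup V] [InnerProductSpace ℂ V]
    {W : Type*} [NormedAddCommGroup W] [InnerProductSpace ℂ W]
    (π : UnitaryRep G V) (σ : UnitaryRep G W) : Prop :=
  ∀ ξ : V, ∀ K : Set G, IsCompact K → ∀ ε : ℝ, 0 < ε →
    ∃ (n : ℕ) (η : Fin n → W), ∀ s ∈ K, ‖π.coeff ξ ξ s - ∑ i, σ.coeff (η i) (η i) s‖ < ε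

/-- Two commuting representations `π`, `σ` of `G` on the same space give the representation
`(s, t) ↦ π(s)σ(t)` of `G × G`. -/
def prodOfCommute {G : Type*} [Group G] [TopologicalSpace G] {V : Type*} [NormedAddCommGroup V]
    [InnerProductSpace ℂ V] (π σ : UnitaryRep G V)
    (h : ∀ s t, Commute (π.toHom s) (σ.toHom t)) : UnitaryRep (G × G) V where
  toHom := π.toHom.noncommCoprod σ.toHom h
  continuous_apply v := by
    rw [continuous_iff_continuousAt]
    rintro ⟨s₀, t₀⟩
    have h1 : Tendsto (fun p : G × G => π.toHom p.1 (σ.toHom t₀ v)) (𝓝 (s₀, t₀))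
        (𝓝 (π.toHom s₀ (σ.toHom t₀ v))) :=
      ((π.continuous_apply _).comp continuous_fst).continuousAt
    have h2 : Tendsto (fun p : G × G => σ.toHom p.2 v) (𝓝 (s₀, t₀)) (𝓝 (σ.toHom t₀ v)) :=
      ((σ.continuous_apply _).comp continuous_snd).continuousAt
    have h3 : Tendsto (fun p : G × G => π.toHom p.1 (σ.toHom p.2 v) - π.toHom p.1 (σ.toHom t₀ v))
        (𝓝 (s₀, t₀)) (𝓝 0) := by
      rw [tendsto_iff_norm_sub_tendsto_zero] at h2
      rw [tendsto_zero_iff_norm_tendsto_zero]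
      refine h2.congr fun p => ?_
      rw [← map_sub, LinearIsometryEquiv.norm_map]
    have h4 := h3.add h1
    simpa [ContinuousAt] using h4

end UnitaryRep

/-! ### Translations on `L^p(G)` -/

namespace LCGroup

open Measure

/-- A homomorphism into the linear isometries is strongly continuous as soon as the orbit maps of a
dense set of vectors are continuous at the identity. -/
lemma continuous_of_dense {G V : Type*} [Group G] [TopologicalSpace G]
    [IsTopologicalGroup G] [NormedAddCommGroup V] [NormedSpace ℂ V]
    (π : G →* (V ≃ₗᵢ[ℂ] V)) (S : Set V) (hS : Dense S)
    (h : ∀ v ∈ S, Tendsto (fun s : G => ‖π s v - v‖) (𝓝 1) (𝓝 0)) (v : V) :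
    Continuous fun s : G => π s v := by
  have key : ∀ v, Tendsto (fun s : G => ‖π s v - v‖) (𝓝 1) (𝓝 0) := by
    intro v
    rw [Metric.tendsto_nhds]
    intro ε hε
    obtain ⟨w, hw, hvw⟩ := Metric.mem_closure_iff.1 (hS v) (ε / 4) (by linarith)
    filter_upwards [(Metric.tendsto_nhds.1 (h w hw)) (ε / 4) (by linarith)] with s hs
    rw [dist_eq_norm] at hvw
    simp only [dist_zero_right, norm_norm] at hs ⊢
    have e : π s v - v = π s (v - w) + (π s w - w) - (v - w) := by
      rw [map_sub]; abel
    rw [e]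
    have n1 := norm_sub_le (π s (v - w) + (π s w - w)) (v - w)
    have n2 := norm_add_le (π s (v - w)) (π s w - w)
    rw [LinearIsometryEquiv.norm_map] at n2
    linarith
  rw [continuous_iff_continuousAt]
  intro s₀
  rw [ContinuousAt, tendsto_iff_norm_sub_tendsto_zero]
  have h1 : Tendsto (fun s : G => s₀⁻¹ * s) (𝓝 s₀) (𝓝 1) := by
    have : Continuous fun s : G => s₀⁻¹ * s := by fun_prop
    simpa using this.tendsto s₀
  refine ((key v).comp h1).congr fun s => ?_
  have : π s v - π s₀ v = π s₀ (π (s₀⁻¹ * s) v - v) := by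
    have e : π s v = π s₀ (π (s₀⁻¹ * s) v) := by
      conv_lhs => rw [← mul_inv_cancel_left s₀ s, map_mul]
      rfl
    rw [map_sub, e]
  rw [this, LinearIsometryEquiv.norm_map]
  rfl

variable (G : Type*) [Group G] [TopologicalSpace G] [IsTopologicalGroup G] [LocallyCompactSpace G]

/-- The modular function `Δ`, normalised by `m(As) = Δ(s)m(A)` for a left Haar measure `m`, that is
`∫ f(xs) Δ(s) dm(x) = ∫ f(x) dm(x)`; it is the inverse of Mathlib's modular character. -/
def modularFunction {G : Type*} [Group G] [TopologicalSpace G] [IsTopologicalGroup G]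
    [LocallyCompactSpace G] (s : G) : ℝ≥0 :=
  (modularCharacter s)⁻¹

section
open scoped Pointwise
variable {G}

lemma modularFunction_pos (s : G) : 0 < modularFunction s :=
  inv_pos.2 (modularCharacterFun_pos s)

lemma modularFunction_one : modularFunction (1 : G) = 1 := by
  simp [modularFunction]

lemma modularFunction_mul (s t : G) :
    modularFunction (s * t) = modularFunction s * modularFunction t := by
  simp [modularFunction, mul_comm]

variable [MeasurableSpace G] [BorelSpace G]

lemma map_mul_right_haar (s : G) :
    Measure.map (· * s) (haar : Measure G) = (modularFunction s)⁻¹ • (haar : Measure G) := by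
  have h : (modularFunction s)⁻¹ = haarScalarFactor (Measure.map (· * s) (haar : Measure G)) haar := by
    rw [← modularCharacterFun_eq_haarScalarFactor (haar : Measure G) s]
    simp [modularFunction, modularCharacter]
  have : (haar : Measure G).Regular := by unfold haar; infer_instance
  have : (Measure.map (· * s) (haar : Measure G)).Regular :=
    Regular.map (Homeomorph.mulRight s)
  rw [h]
  exact isMulLeftInvariant_eq_smul_of_regular _ _

/-- The normalisation of the modular function: `m(As) = Δ(s)m(A)`. -/
lemma haar_mul_right (s : G) (A : Set G) :
    (haar : Measure G) ((· * s) '' A) = modularFunction s * (haar : Measure G) A := by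
  have h : Measure.map (Homeomorph.mulRight s⁻¹).toMeasurableEquiv (haar : Measure G) A
      = (modularFunction s⁻¹)⁻¹ * (haar : Measure G) A := by
    have := map_mul_right_haar s⁻¹
    change Measure.map (· * s⁻¹) _ A = _
    rw [this]; rfl
  rw [MeasurableEquiv.map_apply] at h
  have h2 : (modularFunction s⁻¹)⁻¹ = modularFunction s := by
    simp [modularFunction]
  rw [h2] at h
  rw [← h]
  congr 1
  ext x
  simp

lemma continuousOn_integral_mul_right {E : Type*} [NormedAddCommGroup E] [NormedSpace ℝ E]
    {F : G → G → E} (hF : Continuous (Function.uncurry F)) {K : Set G} (hK : IsCompact K)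
    (h0 : ∀ s x, x * s ∉ K → x ∉ K → F s x = 0) :
    Continuous fun s => ∫ x, F s x ∂(haar : Measure G) := by
  rw [continuous_iff_continuousAt]
  intro s₀
  obtain ⟨V, hV, hVs⟩ := exists_compact_mem_nhds s₀
  have hk : IsCompact (K * V⁻¹ ∪ K) := (hK.mul hV.inv).union hK
  refine (continuousOn_integral_of_compact_support (s := V) hk hF.continuousOn ?_).continuousAt hVs
  intro s x hs hx
  refine h0 s x (fun h => hx (Or.inl ?_)) (fun h => hx (Or.inr h))
  exact ⟨x * s, h, s⁻¹, Set.inv_mem_inv.2 hs, by simp⟩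

lemma continuous_modularFunction : Continuous (modularFunction : G → ℝ≥0) := by
  obtain ⟨⟨f, f_cont⟩, f_comp, f_nonneg, f_one⟩ :
    ∃ f : C(G, ℝ), HasCompactSupport f ∧ 0 ≤ f ∧ f 1 ≠ 0 := exists_continuous_nonneg_pos 1
  have hpos : 0 < ∫ x, f x ∂(haar : Measure G) :=
    f_cont.integral_pos_of_hasCompactSupport_nonneg_nonzero f_comp f_nonneg f_one
  have h1 : Continuous fun s : G => ∫ x, f (x * s) ∂(haar : Measure G) := by
    refine continuousOn_integral_mul_right (F := fun s x => f (x * s)) (by fun_prop) f_comp ?_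
    intro s x hx _
    exact image_eq_zero_of_notMem_tsupport hx
  have h2 : ∀ s : G, ((modularFunction s : ℝ≥0) : ℝ)⁻¹
      = (∫ x, f (x * s) ∂(haar : Measure G)) / ∫ x, f x ∂(haar : Measure G) := by
    intro s
    have : ∫ x, f (x * s) ∂(haar : Measure G)
        = ∫ x, f x ∂(Measure.map (· * s) (haar : Measure G)) := by
      rw [integral_map (by fun_prop) f_cont.aestronglyMeasurable]
    rw [this, map_mul_right_haar, integral_smul_nnreal_measure, eq_div_iff hpos.ne']
    simp [NNReal.smul_def]
  have h3 : Continuous fun s : G => ((modularFunction s : ℝ≥0) : ℝ)⁻¹ := by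
    simp_rw [h2]
    exact h1.div_const _
  have h4 : Continuous fun s : G => ((modularFunction s : ℝ≥0) : ℝ) := by
    have := h3.inv₀ (fun s => (inv_pos.2 (NNReal.coe_pos.2 (modularFunction_pos s))).ne')
    exact this.congr fun s => by simp
  exact continuous_induced_rng.2 h4

lemma memLp_comp_mul_right (p : ℝ≥0∞) (t : G) {f : G → ℂ} (hf : MemLp f p (haar : Measure G)) :
    MemLp (fun x => f (x * t)) p (haar : Measure G) := by
  have h : MemLp f p (Measure.map (· * t) (haar : Measure G)) := by
    rw [map_mul_right_haar]
    exact hf.smul_measure (c := ((modularFunction t)⁻¹ : ℝ≥0)) (by simp)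
  exact h.comp_of_map (by fun_prop)

lemma quasiMeasurePreserving_mul_right_haar (t : G) :
    QuasiMeasurePreserving (· * t) (haar : Measure G) haar :=
  ⟨by fun_prop, by
    rw [map_mul_right_haar]
    exact Measure.smul_absolutelyContinuous (c := (((modularFunction t)⁻¹ : ℝ≥0) : ℝ≥0∞))⟩

lemma eLpNorm_comp_mul_right (p : ℝ≥0∞) [Fact (1 ≤ p)] (t : G) {f : G → ℂ}
    (hf : MemLp f p (haar : Measure G)) :
    eLpNorm (fun x => (((modularFunction t : ℝ) ^ (1 / p.toReal) : ℝ) : ℂ) * f (x * t)) p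
      (haar : Measure G) = eLpNorm f p (haar : Measure G) := by
  have hΔ : modularFunction t ≠ 0 := (modularFunction_pos t).ne'
  have h1 : eLpNorm (fun x => f (x * t)) p (haar : Measure G)
      = eLpNorm f p (Measure.map (· * t) (haar : Measure G)) := by
    rw [eLpNorm_map_measure _ (by fun_prop)]
    · rfl
    · rw [map_mul_right_haar]
      exact hf.1.smul_measure _
  have h2 : (fun x => (((modularFunction t : ℝ) ^ (1 / p.toReal) : ℝ) : ℂ) * f (x * t))
      = (((modularFunction t : ℝ) ^ (1 / p.toReal) : ℝ) : ℂ) • fun x => f (x * t) := rfl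
  rw [h2, eLpNorm_const_smul, h1, map_mul_right_haar, eLpNorm_smul_measure_of_ne_zero' (by simpa)]
  have h3 : ‖(((modularFunction t : ℝ) ^ (1 / p.toReal) : ℝ) : ℂ)‖ₑ
      = ((modularFunction t ^ (1 / p.toReal) : ℝ≥0) : ℝ≥0∞) := by
    rw [← NNReal.coe_rpow]
    simp only [enorm_eq_nnnorm, Complex.nnnorm_real, NNReal.nnnorm_eq]
  rw [h3, ENNReal.smul_def, smul_eq_mul, ← mul_assoc, ← ENNReal.coe_mul, NNReal.inv_rpow, one_div,
    mul_inv_cancel₀ (by simp [NNReal.rpow_eq_zero_iff, hΔ])]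
  simp

end

/-- Continuous functions with compact support are dense in `L^p(G)`. -/
lemma exists_compactSupport_approx {G : Type*} [Group G] [TopologicalSpace G] [IsTopologicalGroup G]
    [LocallyCompactSpace G] [MeasurableSpace G] [BorelSpace G] {p : ℝ≥0∞} (hp : p ≠ ∞)
    {f : G → ℂ} (hf : MemLp f p (haar : Measure G)) {ε : ℝ≥0∞} (hε : ε ≠ 0) :
    ∃ g : G → ℂ, eLpNorm (f - g) p (haar : Measure G) ≤ ε ∧
      (Continuous g ∧ MemLp g p (haar : Measure G) ∧ HasCompactSupport g) := by
  have : (haar : Measure G).Regular := by unfold haar; infer_instance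
  apply hf.induction_dense hp _ _ _ _ hε
  rotate_left
  · rintro f g ⟨f1, f2, f3⟩ ⟨g1, g2, g3⟩
    exact ⟨f1.add g1, f2.add g2, f3.add g3⟩
  · rintro f ⟨-, f2, -⟩
    exact f2.aestronglyMeasurable
  intro c t ht htμ ε hε
  obtain ⟨η, ηpos, hη⟩ : ∃ η : ℝ≥0, 0 < η ∧ ∀ s : Set G, (haar : Measure G) s ≤ η →
      eLpNorm (s.indicator fun _ => c) p (haar : Measure G) ≤ ε :=
    exists_eLpNorm_indicator_le hp c hε
  have hη2 : ((η / 2 : ℝ≥0) : ℝ≥0∞) ≠ 0 := by simpa using ηpos.ne'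
  obtain ⟨s, st, s_compact, s_closed, μs⟩ := ht.exists_isCompact_isClosed_sdiff_lt htμ.ne hη2
  obtain ⟨u, tu, u_open, -, μu⟩ := ht.exists_isOpen_sdiff_lt htμ.ne hη2
  obtain ⟨φ, hφ1, hφ0, hφc, hφ⟩ := exists_continuous_one_zero_of_isCompact s_compact
    u_open.isClosed_compl (Set.disjoint_compl_right_iff_subset.2 (st.trans tu))
  have hcont : Continuous fun x => (φ x : ℂ) * c := by fun_prop
  have hsupp : HasCompactSupport fun x => (φ x : ℂ) * c := by
    refine hφc.mono fun x hx => ?_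
    contrapose! hx
    rw [Function.notMem_support] at hx ⊢
    simp [hx]
  refine ⟨fun x => (φ x : ℂ) * c, ?_, hcont, hcont.memLp_of_hasCompactSupport hsupp, hsupp⟩
  refine le_trans (eLpNorm_mono (g := (u \ s).indicator fun _ => c) fun x => ?_) (hη _ ?_)
  · by_cases hxs : x ∈ s
    · simp [hφ1 hxs, st hxs, hxs]
    · by_cases hxu : x ∈ u
      · rw [Set.indicator_of_mem (show x ∈ u \ s from ⟨hxu, hxs⟩)]
        have h0 := (hφ x).1
        have h1 := (hφ x).2
        have hx : ‖((φ x : ℝ) : ℂ)‖ ≤ 1 := by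
          rw [Complex.norm_real, Real.norm_eq_abs, abs_le]; constructor <;> linarith
        have hx' : ‖((φ x : ℝ) : ℂ) - 1‖ ≤ 1 := by
          rw [← Complex.ofReal_one, ← Complex.ofReal_sub, Complex.norm_real, Real.norm_eq_abs,
            abs_le]
          constructor <;> linarith
        by_cases hxt : x ∈ t
        · have : (φ x : ℂ) * c - c = ((φ x : ℂ) - 1) * c := by ring
          simpa [hxt, this] using mul_le_of_le_one_left (norm_nonneg c) hx'
        · simpa [hxt] using mul_le_of_le_one_left (norm_nonneg c) hx
      · have : x ∉ t := fun h => hxu (tu h)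
        have h0 : φ x = 0 := hφ0 hxu
        simp [this, h0, hxu]
  · have : u \ s ⊆ (u \ t) ∪ (t \ s) := fun x hx => by
      by_cases hxt : x ∈ t
      · exact Or.inr ⟨hxt, hx.2⟩
      · exact Or.inl ⟨hx.1, hxt⟩
    calc (haar : Measure G) (u \ s) ≤ haar (u \ t) + haar (t \ s) :=
          (measure_mono this).trans (measure_union_le _ _)
      _ ≤ ((η / 2 : ℝ≥0) : ℝ≥0∞) + ((η / 2 : ℝ≥0) : ℝ≥0∞) := add_le_add μu.le μs.le
      _ = η := by rw [← ENNReal.coe_add, add_halves]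

/-- Linear norm-preserving operators, multiplicative in the group element, as a homomorphism into the
linear isometric automorphisms. -/
def isometryHom {G V : Type*} [Group G] [NormedAddCommGroup V] [NormedSpace ℂ V]
    (U : G → V →ₗ[ℂ] V) (hU : ∀ s v, ‖U s v‖ = ‖v‖) (h1 : ∀ v, U 1 v = v)
    (hmul : ∀ s t v, U (s * t) v = U s (U t v)) : G →* (V ≃ₗᵢ[ℂ] V) where
  toFun s :=
    { toLinearEquiv := LinearEquiv.ofLinearMap (U s) (U s⁻¹)
        (by ext v; simp [← hmul, h1]) (by ext v; simp [← hmul, h1])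
      norm_map' := hU s }
  map_one' := by ext v; exact h1 v
  map_mul' s t := by ext v; exact hmul s t v

section
variable {G}
variable [MeasurableSpace G] [BorelSpace G] (p : ℝ≥0∞) [Fact (1 ≤ p)]

/-- Left translation on `L^p(G)`: `(λ_p(s)f)(x) = f(s⁻¹x)`. -/
def leftTranslation : G →* (Lp ℂ p (haar : Measure G) ≃ₗᵢ[ℂ] Lp ℂ p (haar : Measure G)) :=
  isometryHom
    (fun s => Lp.compMeasurePreservingₗ ℂ (s⁻¹ * ·) (measurePreserving_mul_left haar s⁻¹))
    (fun s f => Lp.norm_compMeasurePreserving f (measurePreserving_mul_left haar s⁻¹))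
    (fun f => by
      refine Lp.ext ((Lp.coeFn_compMeasurePreserving f
        (measurePreserving_mul_left haar (1 : G)⁻¹)).trans ?_)
      exact Eventually.of_forall fun x => by simp)
    (fun s t f => by
      refine Lp.ext ((Lp.coeFn_compMeasurePreserving f
        (measurePreserving_mul_left haar (s * t)⁻¹)).trans ?_)
      have h1 := Lp.coeFn_compMeasurePreserving
        (Lp.compMeasurePreserving (t⁻¹ * ·) (measurePreserving_mul_left haar t⁻¹) f)
        (measurePreserving_mul_left haar s⁻¹)
      have h2 := (measurePreserving_mul_left (haar : Measure G) s⁻¹).quasiMeasurePreserving.ae_eq_comp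
        (Lp.coeFn_compMeasurePreserving f (measurePreserving_mul_left haar t⁻¹))
      refine (h1.trans (h2.trans ?_)).symm
      exact Eventually.of_forall fun x => by simp [mul_assoc])

lemma coeFn_leftTranslation (s : G) (f : Lp ℂ p (haar : Measure G)) :
    leftTranslation p s f =ᵐ[haar] fun x => f (s⁻¹ * x) :=
  Lp.coeFn_compMeasurePreserving f (measurePreserving_mul_left haar s⁻¹)

/-- The operator `f ↦ (x ↦ Δ(t)^{1/p} f(xt))` on `L^p(G)`, with `1/p = 0` for `p = ∞`. -/
def rightOp (p : ℝ≥0∞) (t : G) : Lp ℂ p (haar : Measure G) →ₗ[ℂ] Lp ℂ p (haar : Measure G) where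
  toFun f := ((memLp_comp_mul_right p t (Lp.memLp f)).const_mul
    (((modularFunction t : ℝ) ^ (1 / p.toReal) : ℝ) : ℂ)).toLp _
  map_add' f g := by
    rw [← MemLp.toLp_add]
    refine MemLp.toLp_congr _ _ ?_
    filter_upwards [(quasiMeasurePreserving_mul_right_haar t).ae_eq_comp (Lp.coeFn_add f g)]
      with x hx
    simp only [Function.comp_apply, Pi.add_apply] at hx ⊢
    rw [hx, mul_add]
  map_smul' c f := by
    rw [RingHom.id_apply, ← MemLp.toLp_const_smul]
    refine MemLp.toLp_congr _ _ ?_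
    filter_upwards [(quasiMeasurePreserving_mul_right_haar t).ae_eq_comp (Lp.coeFn_smul c f)]
      with x hx
    simp only [Function.comp_apply, Pi.smul_apply, smul_eq_mul] at hx ⊢
    rw [hx, mul_left_comm]

lemma coeFn_rightOp (p : ℝ≥0∞) (t : G) (f : Lp ℂ p (haar : Measure G)) :
    rightOp p t f =ᵐ[haar]
      fun x => (((modularFunction t : ℝ) ^ (1 / p.toReal) : ℝ) : ℂ) * f (x * t) :=
  MemLp.coeFn_toLp ((memLp_comp_mul_right p t (Lp.memLp f)).const_mul
    (((modularFunction t : ℝ) ^ (1 / p.toReal) : ℝ) : ℂ))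

/-- Right translation on `L^p(G)`: `(ρ_p(t)f)(x) = Δ(t)^{1/p} f(xt)`. -/
def rightTranslation : G →* (Lp ℂ p (haar : Measure G) ≃ₗᵢ[ℂ] Lp ℂ p (haar : Measure G)) :=
  isometryHom (rightOp p)
    (fun t f => by
      rw [Lp.norm_def, Lp.norm_def, eLpNorm_congr_ae (coeFn_rightOp p t f),
        eLpNorm_comp_mul_right p t (Lp.memLp f)])
    (fun f => by
      refine Lp.ext ((coeFn_rightOp p 1 f).trans ?_)
      exact Eventually.of_forall fun x => by simp [modularFunction_one])
    (fun s t f => by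
      refine Lp.ext ((coeFn_rightOp p (s * t) f).trans ?_)
      have h2 := (quasiMeasurePreserving_mul_right_haar s).ae_eq_comp (coeFn_rightOp p t f)
      filter_upwards [coeFn_rightOp p s (rightOp p t f), h2] with x hx hx2
      simp only [Function.comp_apply] at hx2
      rw [hx, hx2, modularFunction_mul, NNReal.coe_mul,
        Real.mul_rpow (NNReal.coe_nonneg _) (NNReal.coe_nonneg _), Complex.ofReal_mul, mul_assoc,
        mul_assoc x])

lemma coeFn_rightTranslation (t : G) (f : Lp ℂ p (haar : Measure G)) :
    rightTranslation p t f =ᵐ[haar]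
      fun x => (((modularFunction t : ℝ) ^ (1 / p.toReal) : ℝ) : ℂ) * f (x * t) :=
  coeFn_rightOp p t f

lemma commute_translations (s t : G) : Commute (leftTranslation p s) (rightTranslation p t) := by
  refine LinearIsometryEquiv.ext fun f => Lp.ext ?_
  change leftTranslation p s (rightTranslation p t f) =ᵐ[haar]
    rightTranslation p t (leftTranslation p s f)
  have h1 := (measurePreserving_mul_left (haar : Measure G) s⁻¹).quasiMeasurePreserving.ae_eq_comp
    (coeFn_rightTranslation p t f)
  have h2 := (quasiMeasurePreserving_mul_right_haar t).ae_eq_comp (coeFn_leftTranslation p s f)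
  filter_upwards [coeFn_leftTranslation p s (rightTranslation p t f),
    coeFn_rightTranslation p t (leftTranslation p s f), h1, h2] with x a b c d
  simp only [Function.comp_apply] at c d
  rw [a, b, c, d, mul_assoc]

lemma continuous_leftTranslation (hp : p ≠ ∞) (f : Lp ℂ p (haar : Measure G)) :
    Continuous fun s : G => leftTranslation p s f := by
  have : (haar : Measure G).Regular := by unfold haar; infer_instance
  let g : C(G, C(G, G)) := ContinuousMap.curry ⟨fun q : G × G => q.1⁻¹ * q.2, by fun_prop⟩
  exact (continuous_const (y := f)).compMeasurePreservingLp g.continuous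
    (fun s => measurePreserving_mul_left haar s⁻¹) hp

lemma continuous_rightTranslation (hp : p ≠ ∞) (f : Lp ℂ p (haar : Measure G)) :
    Continuous fun t : G => rightTranslation p t f := by
  have : (haar : Measure G).Regular := by unfold haar; infer_instance
  have hp0 : p ≠ 0 := (one_pos.trans_le (Fact.out : 1 ≤ p)).ne'
  have hp1 : 0 < p.toReal := ENNReal.toReal_pos hp0 hp
  refine continuous_of_dense (rightTranslation p)
    {v | ∃ (g : G → ℂ) (hg : MemLp g p (haar : Measure G)), Continuous g ∧ HasCompactSupport g ∧
      v = hg.toLp g} ?_ ?_ f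
  · intro f
    rw [Metric.mem_closure_iff]
    intro ε hε
    obtain ⟨g, h2, h3, h4, h1⟩ := exists_compactSupport_approx hp (Lp.memLp f)
      (ε := ENNReal.ofReal (ε / 2)) (by simpa using hε)
    refine ⟨h4.toLp g, ⟨g, h4, h3, h1, rfl⟩, ?_⟩
    rw [dist_eq_norm, Lp.norm_def, eLpNorm_congr_ae (g := (f : G → ℂ) - g)]
    · refine lt_of_le_of_lt (ENNReal.toReal_mono ENNReal.ofReal_ne_top h2) ?_
      rw [ENNReal.toReal_ofReal (by linarith)]
      linarith
    · filter_upwards [Lp.coeFn_sub f (h4.toLp g), h4.coeFn_toLp] with x a b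
      rw [a, Pi.sub_apply, Pi.sub_apply, b]
  · rintro v ⟨g, hg, gc, gs, rfl⟩
    let F : G → G → ℂ := fun t x =>
      (((modularFunction t : ℝ) ^ (1 / p.toReal) : ℝ) : ℂ) * g (x * t) - g x
    have hΔ : Continuous fun t : G => (modularFunction t : ℝ) ^ (1 / p.toReal) :=
      (NNReal.continuous_coe.comp continuous_modularFunction).rpow_const fun t => Or.inr (by positivity)
    have hF : Continuous (Function.uncurry F) := by
      have := hΔ.comp (continuous_fst (X := G) (Y := G))
      change Continuous fun q : G × G => _
      dsimp only [Function.uncurry, F]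
      exact ((Complex.continuous_ofReal.comp this).mul (gc.comp (by fun_prop))).sub
        (gc.comp continuous_snd)
    have hn : ∀ t, ‖rightTranslation p t (hg.toLp g) - hg.toLp g‖
        = (∫ x, ‖F t x‖ ^ p.toReal ∂(haar : Measure G)) ^ p.toReal⁻¹ := by
      intro t
      have hae : (rightTranslation p t (hg.toLp g) - hg.toLp g : Lp ℂ p (haar : Measure G))
          =ᵐ[haar] F t := by
        filter_upwards [Lp.coeFn_sub (rightTranslation p t (hg.toLp g)) (hg.toLp g),
          coeFn_rightTranslation p t (hg.toLp g), hg.coeFn_toLp,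
          (quasiMeasurePreserving_mul_right_haar t).ae_eq_comp hg.coeFn_toLp] with x a b c d
        simp only [Function.comp_apply] at d
        rw [a, Pi.sub_apply, b, c, d]
      have hm : MemLp (F t) p (haar : Measure G) := (memLp_congr_ae hae).1 (Lp.memLp _)
      rw [Lp.norm_def, eLpNorm_congr_ae hae, hm.eLpNorm_eq_integral_rpow_norm hp0 hp,
        ENNReal.toReal_ofReal (by positivity)]
    simp_rw [hn]
    have hc : Continuous fun t => (∫ x, ‖F t x‖ ^ p.toReal ∂(haar : Measure G)) ^ p.toReal⁻¹ := by
      refine Continuous.rpow_const ?_ fun t => Or.inr (by positivity)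
      refine continuousOn_integral_mul_right (F := fun t x => ‖F t x‖ ^ p.toReal)
        (hF.norm.rpow_const fun t => Or.inr hp1.le) gs ?_
      intro s x h1 h2
      simp [F, image_eq_zero_of_notMem_tsupport h1, image_eq_zero_of_notMem_tsupport h2, hp1.ne']
    have := hc.tendsto 1
    simpa [F, modularFunction_one, hp1.ne'] using this

end

/-! ### The regular representations -/

section

variable [MeasurableSpace G] [BorelSpace G]

/-- The left regular representation `λ_G` on `L²(G)`. -/
def leftRegular : UnitaryRep G (Lp ℂ 2 (haar : Measure G)) where
  toHom := leftTranslation 2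
  continuous_apply := continuous_leftTranslation 2 (by simp)

/-- The right regular representation `ρ_G` on `L²(G)`. -/
def rightRegular : UnitaryRep G (Lp ℂ 2 (haar : Measure G)) where
  toHom := rightTranslation 2
  continuous_apply := continuous_rightTranslation 2 (by simp)

/-- The representation `λ_G·ρ_G` of `G × G` on `L²(G)`, `(s, t) ↦ λ_G(s)ρ_G(t)`. -/
def biregular : UnitaryRep (G × G) (Lp ℂ 2 (haar : Measure G)) :=
  (leftRegular G).prodOfCommute (rightRegular G) (commute_translations 2)

end

/-! ### Quasi-SIN groups -/

section

variable {G}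
variable [MeasurableSpace G] [BorelSpace G]

/-- The isometric conjugation action on `L^p(G)`: `(τ_p(s)f)(x) = Δ(s)^{1/p} f(s⁻¹xs)`. -/
def conjAction (p : ℝ≥0∞) [Fact (1 ≤ p)] (s : G) :
    Lp ℂ p (haar : Measure G) ≃ₗᵢ[ℂ] Lp ℂ p (haar : Measure G) :=
  leftTranslation p s * rightTranslation p s

/-- Convolution on `L¹(G)`, `(f * g)(x) = ∫ f(y) g(y⁻¹x) dy`, as the Bochner integral
`f * g = ∫ f(y) λ₁(y)g dy` in `L¹(G)`. -/
def conv (f g : Lp ℂ 1 (haar : Measure G)) : Lp ℂ 1 (haar : Measure G) :=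
  ∫ y, f y • leftTranslation 1 y g ∂(haar : Measure G)

/-- The integral defining the convolution always converges. -/
lemma integrable_conv (f g : Lp ℂ 1 (haar : Measure G)) :
    Integrable (fun y => f y • leftTranslation 1 y g) (haar : Measure G) := by
  have hcont := continuous_leftTranslation 1 (by simp) g
  have happ : ∀ n : ℕ, ∃ φ : G → ℂ, eLpNorm (φ - (f : G → ℂ)) 1 (haar : Measure G) ≤ (n + 1 : ℝ≥0∞)⁻¹ ∧
      Continuous φ ∧ MemLp φ 1 (haar : Measure G) ∧ HasCompactSupport φ := by
    intro n
    obtain ⟨φ, h⟩ := exists_compactSupport_approx (p := 1) (by simp) (Lp.memLp f)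
      (ε := (n + 1 : ℝ≥0∞)⁻¹) (by simp)
    exact ⟨φ, by rw [eLpNorm_sub_comm]; exact h.1, h.2⟩
  choose φ hφ hφc hφm hφs using happ
  have hlim : Tendsto (fun n => eLpNorm (φ n - (f : G → ℂ)) 1 (haar : Measure G)) atTop (𝓝 0) := by
    refine tendsto_of_tendsto_of_tendsto_of_le_of_le tendsto_const_nhds ?_ (fun _ => zero_le) hφ
    have := (ENNReal.tendsto_inv_nat_nhds_zero).comp (tendsto_add_atTop_nat 1)
    simpa [Function.comp_def] using this
  obtain ⟨ns, -, hns⟩ := (tendstoInMeasure_of_tendsto_eLpNorm one_ne_zero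
    (fun n => (hφm n).1) (Lp.memLp f).1 hlim).exists_seq_tendsto_ae
  have hmeas : AEStronglyMeasurable (fun y => f y • leftTranslation 1 y g) (haar : Measure G) := by
    refine aestronglyMeasurable_of_tendsto_ae (u := atTop)
      (f := fun n y => φ (ns n) y • leftTranslation 1 y g) (fun n => ?_) ?_
    · exact ((hφc (ns n)).smul hcont).stronglyMeasurable_of_hasCompactSupport
        ((hφs (ns n)).smul_right) |>.aestronglyMeasurable
    · filter_upwards [hns] with y hy
      exact hy.smul_const _
  refine (((L1.integrable_coeFn f).norm.mul_const ‖g‖)).mono' hmeas ?_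
  exact Eventually.of_forall fun y => by rw [norm_smul, LinearIsometryEquiv.norm_map]

/-- A net in `L¹(G)` that is a (two-sided) bounded approximate identity for convolution. -/
structure IsBoundedApproximateIdentity {A : Type*} [Preorder A]
    (e : A → Lp ℂ 1 (haar : Measure G)) : Prop where
  bounded : ∃ C : ℝ, ∀ a, ‖e a‖ ≤ C
  left : ∀ f, Tendsto (fun a => conv (e a) f) atTop (𝓝 f)
  right : ∀ f, Tendsto (fun a => conv f (e a)) atTop (𝓝 f)

/-- The net `e` in `L¹(G)` is quasi-invariant: `‖τ₁(s)e_a - e_a‖₁ → 0` uniformly for `s` in compact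
subsets of `G`. -/
def IsQuasiInvariant {A : Type*} [Preorder A] (e : A → Lp ℂ 1 (haar : Measure G)) : Prop :=
  ∀ K : Set G, IsCompact K →
    TendstoUniformlyOn (fun a s => ‖conjAction 1 s (e a) - e a‖) (fun _ => 0) atTop K

end

/-- `G` is a QSIN group: `L¹(G)` admits a quasi-invariant bounded approximate identity, that is, a
net indexed by a nonempty directed set. -/
def IsQSIN (G : Type u) [Group G] [TopologicalSpace G] [IsTopologicalGroup G]
    [LocallyCompactSpace G] [MeasurableSpace G] [BorelSpace G] : Prop :=
  ∃ (A : Type u) (_ : Preorder A) (_ : IsDirectedOrder A) (_ : Nonempty A)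
    (e : A → Lp ℂ 1 (haar : Measure G)), IsBoundedApproximateIdentity e ∧ IsQuasiInvariant e

end LCGroup

end

/-! Functions on `H` are moved to `G` by smearing along `ι`. Let `k ≥ 0` be a density in `C_c(G)`
with integral 1, supported near the identity, and put `(f * k)(x) = ∫ k(ι(h)⁻¹x) f(h) dh` for `f ∈
C_c(H)`. Since `ι(H)` may be a null set, `f * k` has no controlled `L²` norm. The remedy is a cutoff
`χ` on `H` that equals 1 near the support of `f`, and the function `F = (f * k) / √(χ * k)`. If `k`
is concentrated enough, `f` is nearly constant on the points `h` that contribute at a given `x`.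
Then `f * k ≈ f(h)(χ * k)` there, so `|F|² ≈ |f|² * k`, whose integral is `∫ |f|²`. The same
computation for `f` and one of its translates compares the whole coefficient function
(`norm_mul_conj_div_sqrt_sub_le`, `norm_integral_transfer_sub_le`). Injectivity of `ι` enters here:
on a compact set, points with nearby images are nearby (`exists_nhds_inv_mul_mem`).

Translating `F` by `(ι(s), ι(t))` amounts to translating `f` and `χ` by `(s, t)` and conjugating `k`
by `ι(t)`, with modular factors that match exactly (`transfer_translate`). The conjugated kernel
must therefore be close to `k` in `L¹`, uniformly for `t` in a compact set. This is what QSIN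
supplies (`IsQSIN.exists_density`): the approximate identity is cut off near 1 without spoiling its
approximate invariance. An `L¹` estimate on kernels becomes an `L²` estimate on the functions `F`
because `(B, b) ↦ B / √b` is Hölder of exponent 1/2 on `|B| ≤ M b` (`sq_norm_div_sqrt_sub_le`).

For `f ∈ C_c(H)` a single function `F` suffices; density of `C_c(H)` in `L²(H)` gives the rest. -/

namespace LCGroup

open Measure

/-! ### Almost conjugation-invariant densities supported near the identity -/

section QuasiCentral

variable {G : Type*} [Group G] [TopologicalSpace G] [IsTopologicalGroup G] [LocallyCompactSpace G]
  [MeasurableSpace G] [BorelSpace G]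

instance haar_regular : (haar : Measure G).Regular := by unfold haar; infer_instance

/-- Integration over a set as a continuous functional on `L¹`. -/
noncomputable def setIntegralCLM {X : Type*} [MeasurableSpace X] (μ : Measure X) (V : Set X) :
    Lp ℂ 1 μ →L[ℂ] ℂ :=
  LinearMap.mkContinuous
    { toFun := fun f => ∫ x in V, f x ∂μ
      map_add' := fun f g => by
        rw [← integral_add (L1.integrable_coeFn f).integrableOn (L1.integrable_coeFn g).integrableOn]
        exact integral_congr_ae (ae_restrict_of_ae (Lp.coeFn_add f g))
      map_smul' := fun c f => by
        rw [RingHom.id_apply, ← integral_smul]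
        exact integral_congr_ae (ae_restrict_of_ae (Lp.coeFn_smul c f)) }
    1 fun f => by
      rw [one_mul, L1.norm_eq_integral_norm]
      exact (norm_integral_le_integral_norm _).trans
        (setIntegral_le_integral (L1.integrable_coeFn f).norm
          (Eventually.of_forall fun x => norm_nonneg _))

/-- A bounded approximate identity carries mass near the identity. -/
lemma IsBoundedApproximateIdentity.eventually_lt_setIntegral [T2Space G] {A : Type*} [Preorder A]
    {e : A → Lp ℂ 1 (haar : Measure G)} (he : IsBoundedApproximateIdentity e) {U : Set G}
    (hU : IsOpen U) (hU1 : 1 ∈ U) :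
    ∀ᶠ a in atTop, 1 / 2 < ∫ x in U, ‖e a x‖ ∂(haar : Measure G) := by
  -- Test on the indicator of a compact `V` with `V V⁻¹ ⊆ U`. For `y ∉ U` the translate `yV` misses
  -- `V`, so `∫_V f * 1_V` is at most `m(V) ∫_U |f|`. For `f = e a` the left side tends to `m(V)`.
  obtain ⟨V₀, hV₀, hV₀U⟩ := exists_nhds_split_inv (hU.mem_nhds hU1)
  obtain ⟨V, ⟨hV, hVc⟩, hVV₀⟩ := (compact_basis_nhds (1 : G)).mem_iff.1 hV₀
  have hVm : MeasurableSet V := hVc.isClosed.measurableSet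
  have hVfin : (haar : Measure G) V ≠ ∞ := hVc.measure_lt_top.ne
  have hVpos : 0 < (haar : Measure G).real V :=
    ENNReal.toReal_pos (measure_pos_of_mem_nhds _ hV).ne' hVfin
  set g : Lp ℂ 1 (haar : Measure G) := indicatorConstLp 1 hVm hVfin (1 : ℂ) with hg
  have hgn : ‖g‖ = (haar : Measure G).real V := by
    rw [hg, norm_indicatorConstLp one_ne_zero ENNReal.one_ne_top]; simp
  set T := setIntegralCLM (haar : Measure G) V
  have hTg : T g = ((haar : Measure G).real V : ℂ) := by
    change ∫ x in V, g x ∂(haar : Measure G) = _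
    rw [setIntegral_congr_ae (g := fun _ => (1 : ℂ)) hVm indicatorConstLp_coeFn_mem]
    simp
  have hTn : ∀ f, ‖T f‖ ≤ ‖f‖ := fun f => by
    simpa using T.le_of_opNorm_le (LinearMap.mkContinuous_norm_le _ zero_le_one _) f
  have hT0 : ∀ y ∉ U, T (leftTranslation 1 y g) = 0 := by
    intro y hy
    change ∫ x in V, leftTranslation 1 y g x ∂(haar : Measure G) = _
    rw [setIntegral_congr_ae (g := fun _ => (0 : ℂ)) hVm, integral_zero]
    filter_upwards [coeFn_leftTranslation 1 y g,
      (measurePreserving_mul_left (haar : Measure G) y⁻¹).quasiMeasurePreserving.ae_eq_comp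
        (indicatorConstLp_coeFn (p := 1) (hs := hVm) (hμs := hVfin) (c := (1 : ℂ)))] with x h1 h2 hx
    simp only [Function.comp_apply] at h2
    rw [h1, h2, Set.indicator_of_notMem]
    intro hyx
    refine hy ?_
    have := hV₀U x (hVV₀ hx) _ (hVV₀ hyx)
    simpa [div_eq_mul_inv] using this
  have hbound : ∀ f : Lp ℂ 1 (haar : Measure G),
      ‖T (conv f g)‖ ≤ (∫ x in U, ‖f x‖ ∂(haar : Measure G)) * (haar : Measure G).real V := by
    intro f
    rw [conv, ← T.integral_comp_comm (integrable_conv f g), ← integral_mul_const,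
      ← integral_indicator hU.measurableSet]
    refine norm_integral_le_of_norm_le
      (((L1.integrable_coeFn f).norm.mul_const _).indicator hU.measurableSet)
      (Eventually.of_forall fun y => ?_)
    by_cases hy : y ∈ U
    · rw [Set.indicator_of_mem hy, map_smul, norm_smul, ← hgn]
      refine mul_le_mul_of_nonneg_left ((hTn _).trans ?_) (norm_nonneg _)
      rw [LinearIsometryEquiv.norm_map]
    · rw [Set.indicator_of_notMem hy, map_smul, hT0 y hy]; simp
  have hlim : Tendsto (fun a => ‖T (conv (e a) g)‖) atTop (𝓝 ((haar : Measure G).real V)) := by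
    have := ((T.continuous.tendsto _).comp (he.left g)).norm
    rw [hTg] at this
    simpa [Function.comp_def, abs_of_pos hVpos] using this
  filter_upwards [hlim.eventually (lt_mem_nhds (half_lt_self hVpos))] with a ha
  have := ha.trans_le (hbound (e a))
  nlinarith

lemma coeFn_conjAction (p : ℝ≥0∞) [Fact (1 ≤ p)] (s : G) (f : Lp ℂ p (haar : Measure G)) :
    conjAction p s f =ᵐ[haar]
      fun x => (((modularFunction s : ℝ) ^ (1 / p.toReal) : ℝ) : ℂ) * f (s⁻¹ * x * s) := by
  have h := (measurePreserving_mul_left (haar : Measure G) s⁻¹).quasiMeasurePreserving.ae_eq_comp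
    (coeFn_rightTranslation p s f)
  filter_upwards [coeFn_leftTranslation p s (rightTranslation p s f), h] with x h1 h2
  simp only [Function.comp_apply] at h2
  exact h1.trans h2

/-- The norm of `τ₁(s)f - f`, computed from a representative `g` of `f`. -/
lemma norm_conjAction_sub {g : G → ℂ} (hg : MemLp g 1 (haar : Measure G)) (s : G) :
    Integrable (fun x => ‖(modularFunction s : ℂ) * g (s⁻¹ * x * s) - g x‖) (haar : Measure G) ∧
    ‖conjAction 1 s (hg.toLp g) - hg.toLp g‖
      = ∫ x, ‖(modularFunction s : ℂ) * g (s⁻¹ * x * s) - g x‖ ∂(haar : Measure G) := by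
  have h2 := (quasiMeasurePreserving_mul_right_haar s).ae_eq_comp hg.coeFn_toLp
  have h3 := (measurePreserving_mul_left (haar : Measure G) s⁻¹).quasiMeasurePreserving.ae_eq_comp h2
  have hae : (fun x => ‖(conjAction 1 s (hg.toLp g) - hg.toLp g : Lp ℂ 1 (haar : Measure G)) x‖)
      =ᵐ[haar] fun x => ‖(modularFunction s : ℂ) * g (s⁻¹ * x * s) - g x‖ := by
    filter_upwards [Lp.coeFn_sub (conjAction 1 s (hg.toLp g)) (hg.toLp g),
      coeFn_conjAction 1 s (hg.toLp g), hg.coeFn_toLp, h3] with x a b c d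
    simp only [Function.comp_apply] at d
    rw [a, Pi.sub_apply, b, c, d]
    simp
  refine ⟨(integrable_congr hae).1 (L1.integrable_coeFn _).norm, ?_⟩
  rw [L1.norm_eq_integral_norm, integral_congr_ae hae]

/-- The limit of the mass of a bounded net carried by small neighbourhoods of a point. -/
lemma exists_mass_at {X A : Type*} [TopologicalSpace X] [Preorder A] [IsDirectedOrder A] [Nonempty A]
    {x₀ : X} (I : Set X → A → ℝ) (C c₀ : ℝ) (hC : ∀ U a, I U a ≤ C)
    (h₀ : ∀ U, IsOpen U → x₀ ∈ U → ∀ᶠ a in atTop, c₀ < I U a) :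
    ∃ c ≥ c₀, ∀ δ > 0, (∃ U, IsOpen U ∧ x₀ ∈ U ∧ ∀ᶠ a in atTop, I U a ≤ c + δ) ∧
      ∀ W, IsOpen W → x₀ ∈ W → ∃ᶠ a in atTop, c - δ < I W a := by
  -- The supremum of this set is the infimum over the neighbourhoods `U` of `limsup I U`.
  let S : Set ℝ := {c | ∀ U, IsOpen U → x₀ ∈ U → ∃ᶠ a in atTop, c < I U a}
  have hc₀ : c₀ ∈ S := fun U hU h1 => (h₀ U hU h1).frequently
  have hS : BddAbove S := by
    refine ⟨C, fun c hc => ?_⟩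
    obtain ⟨a, ha⟩ := (hc Set.univ isOpen_univ trivial).exists
    exact ha.le.trans (hC _ _)
  refine ⟨sSup S, le_csSup hS hc₀, fun δ hδ => ⟨?_, fun W hW h1 => ?_⟩⟩
  · have : sSup S + δ ∉ S := fun h => by linarith [le_csSup hS h]
    simp only [S, Set.mem_ofPred_eq, not_forall, not_frequently, not_lt] at this
    obtain ⟨U, hU, h1, h⟩ := this
    exact ⟨U, hU, h1, h⟩
  · obtain ⟨c, hc, hlt⟩ := exists_lt_of_lt_csSup ⟨c₀, hc₀⟩ (sub_lt_self (sSup S) hδ)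
    exact (hc W hW h1).mono fun a ha => hlt.trans ha

lemma abs_setIntegral_norm_sub_le {X : Type*} [MeasurableSpace X] {μ : Measure X} {f g : X → ℂ}
    (hf : Integrable f μ) (hg : Integrable g μ) (U : Set X) :
    |(∫ x in U, ‖f x‖ ∂μ) - ∫ x in U, ‖g x‖ ∂μ| ≤ ∫ x, ‖f x - g x‖ ∂μ := by
  rw [← integral_sub hf.norm.integrableOn hg.norm.integrableOn]
  refine (abs_integral_le_integral_abs).trans ?_
  refine (integral_mono (hf.norm.sub hg.norm).abs.integrableOn (hf.sub hg).norm.integrableOn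
    fun x => abs_norm_sub_norm_le _ _).trans ?_
  exact setIntegral_le_integral (hf.sub hg).norm (Eventually.of_forall fun x => norm_nonneg _)

/-- A QSIN group has approximately conjugation invariant probability densities in `C_c(G)` that
are supported in arbitrarily small neighbourhoods of the identity. -/
theorem IsQSIN.exists_density {G : Type u} [Group G] [TopologicalSpace G] [IsTopologicalGroup G]
    [LocallyCompactSpace G] [MeasurableSpace G] [BorelSpace G] [T2Space G] (hG : IsQSIN G)
    {K : Set G} (hK : IsCompact K) {U : Set G} (hU : U ∈ 𝓝 1) {ε : ℝ} (hε : 0 < ε) :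
    ∃ k : G → ℝ, Continuous k ∧ HasCompactSupport k ∧ (∀ x, 0 ≤ k x) ∧
      ∫ x, k x ∂(haar : Measure G) = 1 ∧ (∀ x, k x ≠ 0 → x ∈ U) ∧
      ∀ s ∈ K, ∫ x, |(modularFunction s : ℝ) * k (s⁻¹ * x * s) - k x| ∂(haar : Measure G) ≤ ε := by
  obtain ⟨A, _, _, _, e, hbai, hqi⟩ := hG
  obtain ⟨C, hC⟩ := hbai.bounded
  -- A cutoff is not conjugation invariant, so it must vary only where there is little mass. With
  -- the limiting mass `c`, some `U₀` eventually carries at most `c + δ`, while every smaller `W`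
  -- still frequently carries more than `c - δ`. Hence `U₀ \ W` carries at most `2δ` for suitable
  -- indices, however small `W` is.
  obtain ⟨c, hc, hcδ⟩ := exists_mass_at (x₀ := (1 : G))
    (fun U a => ∫ x in U, ‖e a x‖ ∂(haar : Measure G)) C (1 / 2)
    (fun U a => by
      refine le_trans ?_ (hC a)
      rw [L1.norm_eq_integral_norm]
      exact setIntegral_le_integral (L1.integrable_coeFn (e a)).norm
        (Eventually.of_forall fun x => norm_nonneg _))
    (fun U hU h1 => hbai.eventually_lt_setIntegral hU h1)
  -- `δ ≤ 1/8` keeps the mass after cutting off at least `c - 2δ ≥ 1/4`. Normalising multiplies the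
  -- error `7δ` by at most 4.
  obtain ⟨δ, hδ, hδ1, hδε⟩ : ∃ δ > 0, δ ≤ 1 / 8 ∧ 28 * δ ≤ ε :=
    ⟨min (1 / 8) (ε / 28), by positivity, min_le_left _ _, by
      linarith [min_le_right (1 / 8) (ε / 28)]⟩
  obtain ⟨⟨U₀, hU₀, h1U₀, hmass⟩, hfreq⟩ := hcδ δ hδ
  -- conjugation by elements of `K` near the identity
  have hconj : ∀ {N : Set G}, N ∈ 𝓝 (1 : G) →
      ∀ᶠ w in 𝓝 (1 : G), ∀ s ∈ K, s * w * s⁻¹ ∈ N ∧ s⁻¹ * w * s ∈ N := by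
    intro N hN
    refine hK.eventually_forall_of_forall_eventually
      (P := fun w s => s * w * s⁻¹ ∈ N ∧ s⁻¹ * w * s ∈ N) fun s _ => ?_
    have h1 : Continuous fun z : G × G => z.2 * z.1 * z.2⁻¹ := by fun_prop
    have h2 : Continuous fun z : G × G => z.2⁻¹ * z.1 * z.2 := by fun_prop
    exact (h1.continuousAt.eventually_mem (by simpa using hN)).and
      (h2.continuousAt.eventually_mem (by simpa using hN))
  -- `U₁` will contain the set where `φ ≠ 0`; its conjugates by `K` stay in `U₀`. Below, the
  -- conjugates of `W` stay in `V`, where `φ = 1`. So `φ` and its conjugates agree on `W` and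
  -- outside `U₀`.
  obtain ⟨U₁, hU₁sub, hU₁, h1U₁⟩ := eventually_nhds_iff.1
    ((hconj (hU₀.mem_nhds h1U₀)).and ((hU₀.eventually_mem h1U₀).and (eventually_mem_set.2 hU)))
  obtain ⟨V, ⟨hV, hVc⟩, hVU₁⟩ := (compact_basis_nhds (1 : G)).mem_iff.1 (hU₁.mem_nhds h1U₁)
  obtain ⟨φ, hφ1, hφ0, hφc, hφ⟩ := exists_continuous_one_zero_of_isCompact hVc
    hU₁.isClosed_compl (Set.disjoint_compl_right_iff_subset.2 hVU₁)
  obtain ⟨W, hWsub, hW, h1W⟩ := eventually_nhds_iff.1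
    ((hconj hV).and ((eventually_mem_set.2 hV).and (hU₀.eventually_mem h1U₀)))
  have hφU₁ : ∀ x, φ x ≠ 0 → x ∈ U₁ := fun x hx => by
    by_contra h
    exact hx (hφ0 h)
  obtain ⟨a, haW, haU₀, haK⟩ := ((hfreq W hW h1W).and_eventually (hmass.and
    ((Metric.tendstoUniformlyOn_iff.1 (hqi K hK)) δ hδ))).exists
  obtain ⟨g, hga, hgc, hgm, hgs⟩ := exists_compactSupport_approx (p := 1) (by simp)
    (Lp.memLp (e a)) (ε := ENNReal.ofReal δ) (by simpa using hδ)
  have hgi : Integrable g (haar : Measure G) := memLp_one_iff_integrable.1 hgm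
  have hei := L1.integrable_coeFn (e a)
  have hdist : ∫ x, ‖g x - e a x‖ ∂(haar : Measure G) ≤ δ := by
    rw [← ENNReal.ofReal_le_ofReal_iff hδ.le]
    change ENNReal.ofReal (∫ x, ‖(g - (e a : G → ℂ)) x‖ ∂(haar : Measure G)) ≤ _
    rw [ofReal_integral_norm_eq_lintegral_enorm (hgi.sub hei),
      ← eLpNorm_one_eq_lintegral_enorm]
    exact (eLpNorm_sub_comm _ _ _ _).trans_le hga
  have hnorm : ‖hgm.toLp g - e a‖ ≤ δ := by
    rw [L1.norm_eq_integral_norm]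
    refine le_of_eq_of_le (integral_congr_ae ?_) hdist
    filter_upwards [Lp.coeFn_sub (hgm.toLp g) (e a), hgm.coeFn_toLp] with x h1 h2
    rw [h1, Pi.sub_apply, h2]
  have hgU₀ := (abs_le.1 ((abs_setIntegral_norm_sub_le hgi hei U₀).trans hdist)).2
  have hgW := (abs_le.1 ((abs_setIntegral_norm_sub_le hgi hei W).trans hdist)).1
  set k₀ : G → ℝ := fun x => φ x * ‖g x‖ with hk₀
  have hk₀c : Continuous k₀ := φ.continuous.mul hgc.norm
  have hk₀s : HasCompactSupport k₀ := hφc.mul_right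
  have hk₀0 : ∀ x, 0 ≤ k₀ x := fun x => mul_nonneg (hφ x).1 (norm_nonneg _)
  have hk₀i : Integrable k₀ (haar : Measure G) := hk₀c.integrable_of_hasCompactSupport hk₀s
  have hm : 1 / 4 ≤ ∫ x, k₀ x ∂(haar : Measure G) := by
    have h1 : ∫ x in W, ‖g x‖ ∂(haar : Measure G) ≤ ∫ x, k₀ x ∂(haar : Measure G) := by
      rw [← integral_indicator hW.measurableSet]
      refine integral_mono (hgi.norm.indicator hW.measurableSet) hk₀i fun x => ?_
      by_cases hx : x ∈ W
      · rw [Set.indicator_of_mem hx]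
        have : φ x = 1 := hφ1 (hWsub x hx).2.1
        simp [hk₀, this]
      · rw [Set.indicator_of_notMem hx]
        exact hk₀0 x
    linarith
  -- `3δ` comes from the quasi-invariance of `e a` and two replacements of `e a` by `g`; `4δ` bounds
  -- the mass of `|g|` on `U₀ \ W`.
  have hconjk : ∀ s ∈ K, ∫ x, |(modularFunction s : ℝ) * k₀ (s⁻¹ * x * s) - k₀ x|
      ∂(haar : Measure G) ≤ 7 * δ := by
    intro s hs
    obtain ⟨hsi, hsn⟩ := norm_conjAction_sub hgm s
    have h1 : ∫ x, ‖(modularFunction s : ℂ) * g (s⁻¹ * x * s) - g x‖ ∂(haar : Measure G)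
        ≤ 3 * δ := by
      rw [← hsn]
      have e1 : conjAction 1 s (hgm.toLp g) - hgm.toLp g
          = conjAction 1 s (hgm.toLp g - e a) + (conjAction 1 s (e a) - e a)
            - (hgm.toLp g - e a) := by
        rw [map_sub]; abel
      have e2 : ‖conjAction 1 s (e a) - e a‖ < δ := by simpa using haK s hs
      rw [e1]
      refine (norm_sub_le _ _).trans ((add_le_add_left (norm_add_le _ _) _).trans ?_)
      rw [LinearIsometryEquiv.norm_map]
      linarith
    have h2 : Integrable (fun x => U₀.indicator (fun x => ‖g x‖) x - W.indicator (fun x => ‖g x‖) x)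
        (haar : Measure G) :=
      (hgi.norm.indicator hU₀.measurableSet).sub (hgi.norm.indicator hW.measurableSet)
    have h3 : ∫ x, (U₀.indicator (fun x => ‖g x‖) x - W.indicator (fun x => ‖g x‖) x)
        ∂(haar : Measure G) ≤ 4 * δ := by
      rw [integral_sub (hgi.norm.indicator hU₀.measurableSet)
        (hgi.norm.indicator hW.measurableSet), integral_indicator hU₀.measurableSet,
        integral_indicator hW.measurableSet]
      linarith
    calc ∫ x, |(modularFunction s : ℝ) * k₀ (s⁻¹ * x * s) - k₀ x| ∂(haar : Measure G)
        ≤ ∫ x, (‖(modularFunction s : ℂ) * g (s⁻¹ * x * s) - g x‖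
            + (U₀.indicator (fun x => ‖g x‖) x - W.indicator (fun x => ‖g x‖) x))
            ∂(haar : Measure G) := by
          refine integral_mono_of_nonneg (Eventually.of_forall fun x => abs_nonneg _)
            (hsi.add h2) (Eventually.of_forall fun x => ?_)
          set y := s⁻¹ * x * s with hy
          have hxy : x = s * y * s⁻¹ := by rw [hy]; group
          have b1 : |(modularFunction s : ℝ) * ‖g y‖ - ‖g x‖|
              ≤ ‖(modularFunction s : ℂ) * g y - g x‖ := by
            have := abs_norm_sub_norm_le ((modularFunction s : ℂ) * g y) (g x)
            simpa using this
          have b2 : |φ y - φ x| * ‖g x‖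
              ≤ U₀.indicator (fun x => ‖g x‖) x - W.indicator (fun x => ‖g x‖) x := by
            by_cases hxW : x ∈ W
            · have p1 : φ x = 1 := hφ1 (hWsub x hxW).2.1
              have p2 : φ y = 1 := hφ1 ((hWsub x hxW).1 s hs).2
              rw [Set.indicator_of_mem hxW, Set.indicator_of_mem (hWsub x hxW).2.2, p1, p2]
              simp
            · rw [Set.indicator_of_notMem hxW, sub_zero]
              by_cases hxU : x ∈ U₀
              · rw [Set.indicator_of_mem hxU]
                refine mul_le_of_le_one_left (norm_nonneg _) ?_
                rw [abs_le]
                constructor <;> linarith [(hφ x).1, (hφ x).2, (hφ y).1, (hφ y).2]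
              · have p1 : φ x = 0 := by
                  by_contra h
                  exact hxU (hU₁sub x (hφU₁ x h)).2.1
                have p2 : φ y = 0 := by
                  by_contra h
                  exact hxU (by rw [hxy]; exact ((hU₁sub y (hφU₁ y h)).1 s hs).1)
                rw [Set.indicator_of_notMem hxU, p1, p2]
                simp
          -- The first term is controlled by the invariance of `g`; the second lives on `U₀ \ W`.
          have b3 : (modularFunction s : ℝ) * k₀ y - k₀ x
              = φ y * ((modularFunction s : ℝ) * ‖g y‖ - ‖g x‖) + (φ y - φ x) * ‖g x‖ := by
            simp only [hk₀]; ring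
          refine (le_of_eq (congrArg _ b3)).trans ((abs_add_le _ _).trans (add_le_add ?_ ?_))
          · rw [abs_mul, abs_of_nonneg (hφ y).1]
            exact (mul_le_of_le_one_left (abs_nonneg _) (hφ y).2).trans b1
          · rw [abs_mul, abs_norm]
            exact b2
      _ ≤ 7 * δ := by
          rw [integral_add hsi h2]
          linarith
  set m := ∫ x, k₀ x ∂(haar : Measure G) with hmdef
  have hmpos : 0 < m := by linarith
  refine ⟨fun x => m⁻¹ * k₀ x, continuous_const.mul hk₀c, hk₀s.mul_left,
    fun x => mul_nonneg (inv_nonneg.2 hmpos.le) (hk₀0 x), ?_, fun x hx => ?_, fun s hs => ?_⟩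
  · rw [integral_const_mul, inv_mul_cancel₀ hmpos.ne']
  · exact (hU₁sub x (hφU₁ x fun h => hx (by simp [hk₀, h]))).2.2
  · have : ∀ x, |(modularFunction s : ℝ) * (m⁻¹ * k₀ (s⁻¹ * x * s)) - m⁻¹ * k₀ x|
        = m⁻¹ * |(modularFunction s : ℝ) * k₀ (s⁻¹ * x * s) - k₀ x| := fun x => by
      rw [← abs_of_pos (inv_pos.2 hmpos), ← abs_mul, abs_of_pos (inv_pos.2 hmpos)]
      congr 1; ring
    simp_rw [this]
    rw [integral_const_mul, inv_mul_le_iff₀ hmpos]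
    have := hconjk s hs
    nlinarith

end QuasiCentral

/-! ### The function `B / √b` -/

section DivSqrt

/-- The map `(B, b) ↦ B / √b` is Hölder continuous of exponent `1/2` on `‖B‖ ≤ M b`. -/
lemma sq_norm_div_sqrt_sub_le {B B' : ℂ} {b b' M : ℝ} (hb : 0 ≤ b) (hb' : 0 ≤ b')
    (hB : ‖B‖ ≤ M * b) (hB' : ‖B'‖ ≤ M * b') (hM : 0 ≤ M) :
    ‖B / (√b : ℝ) - B' / (√b' : ℝ)‖ ^ 2 ≤ 4 * M * ‖B - B'‖ + 6 * M ^ 2 * |b - b'| := by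
  -- In terms of the bounded ratio `a = B / b` (0 if `b = 0`), the quotient is `a √b`, with no
  -- singularity.
  obtain ⟨a, ha, hBa⟩ : ∃ a : ℂ, ‖a‖ ≤ M ∧ B = a * b := by
    rcases hb.eq_or_lt with h | h
    · refine ⟨0, by simpa using hM, ?_⟩
      rw [← h, mul_zero] at hB
      simp [norm_le_zero_iff.1 hB]
    · refine ⟨B / b, ?_, (div_mul_cancel₀ _ (by exact_mod_cast h.ne')).symm⟩
      rw [norm_div, Complex.norm_real, Real.norm_of_nonneg hb, div_le_iff₀ h]
      exact hB
  obtain ⟨a', ha', hBa'⟩ : ∃ a : ℂ, ‖a‖ ≤ M ∧ B' = a * b' := by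
    rcases hb'.eq_or_lt with h | h
    · refine ⟨0, by simpa using hM, ?_⟩
      rw [← h, mul_zero] at hB'
      simp [norm_le_zero_iff.1 hB']
    · refine ⟨B' / b', ?_, (div_mul_cancel₀ _ (by exact_mod_cast h.ne')).symm⟩
      rw [norm_div, Complex.norm_real, Real.norm_of_nonneg hb', div_le_iff₀ h]
      exact hB'
  have hdiv : ∀ {a : ℂ} {b : ℝ}, 0 ≤ b → a * b / (√b : ℝ) = a * (√b : ℝ) := by
    intro a b hb
    rw [mul_div_assoc, ← Complex.ofReal_div, Real.div_sqrt]
  have e1 : B / (√b : ℝ) - B' / (√b' : ℝ) = (a - a') * (√b : ℝ) + a' * ((√b - √b' : ℝ) : ℂ) := by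
    rw [hBa, hBa', hdiv hb, hdiv hb']
    push_cast
    ring
  have e2 : ‖a - a'‖ * b ≤ ‖B - B'‖ + M * |b - b'| := by
    have : (a - a') * b = (B - B') - a' * ((b - b' : ℝ) : ℂ) := by
      rw [hBa, hBa']; push_cast; ring
    calc ‖a - a'‖ * b = ‖(a - a') * b‖ := by
          rw [norm_mul, Complex.norm_real, Real.norm_of_nonneg hb]
      _ ≤ ‖B - B'‖ + ‖a' * ((b - b' : ℝ) : ℂ)‖ := by rw [this]; exact norm_sub_le _ _
      _ ≤ _ := by
          rw [norm_mul, Complex.norm_real, Real.norm_eq_abs]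
          gcongr
  have e3 : ‖a - a'‖ ≤ 2 * M := (norm_sub_le _ _).trans (by linarith)
  have e4 : (√b - √b') ^ 2 ≤ |b - b'| := by
    have h1 : b - b' = (√b - √b') * (√b + √b') := by
      nlinarith [Real.sq_sqrt hb, Real.sq_sqrt hb']
    have h2 : |√b - √b'| ≤ √b + √b' := by
      rw [abs_le]
      constructor <;> linarith [Real.sqrt_nonneg b, Real.sqrt_nonneg b']
    rw [h1, abs_mul, abs_of_nonneg (add_nonneg (Real.sqrt_nonneg b) (Real.sqrt_nonneg b')),
      ← sq_abs, sq]
    exact mul_le_mul_of_nonneg_left h2 (abs_nonneg _)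
  have e5 : ‖B / (√b : ℝ) - B' / (√b' : ℝ)‖ ≤ ‖a - a'‖ * √b + M * |√b - √b'| := by
    rw [e1]
    refine (norm_add_le _ _).trans ?_
    rw [norm_mul, norm_mul, Complex.norm_real, Complex.norm_real, Real.norm_eq_abs,
      Real.norm_eq_abs, abs_of_nonneg (Real.sqrt_nonneg b)]
    gcongr
  -- Only one of the two factors `‖a - a'‖` can be paired with `b`; the other is bounded by `2M`.
  -- This is where the exponent 1/2 appears.
  have e6 : ‖a - a'‖ ^ 2 * b ≤ 2 * M * (‖B - B'‖ + M * |b - b'|) := by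
    calc ‖a - a'‖ ^ 2 * b = ‖a - a'‖ * (‖a - a'‖ * b) := by ring
      _ ≤ _ := by gcongr
  calc ‖B / (√b : ℝ) - B' / (√b' : ℝ)‖ ^ 2 ≤ (‖a - a'‖ * √b + M * |√b - √b'|) ^ 2 := by gcongr
    _ ≤ 2 * (‖a - a'‖ * √b) ^ 2 + 2 * (M * |√b - √b'|) ^ 2 := by
        nlinarith [sq_nonneg (‖a - a'‖ * √b - M * |√b - √b'|)]
    _ = 2 * (‖a - a'‖ ^ 2 * b) + 2 * M ^ 2 * (√b - √b') ^ 2 := by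
        rw [mul_pow, mul_pow, Real.sq_sqrt hb, sq_abs]; ring
    _ ≤ 2 * (2 * M * (‖B - B'‖ + M * |b - b'|)) + 2 * M ^ 2 * |b - b'| := by gcongr
    _ = _ := by ring

lemma sq_norm_div_sqrt_le {B : ℂ} {b M : ℝ} (hb : 0 ≤ b) (hB : ‖B‖ ≤ M * b) :
    ‖B / (√b : ℝ)‖ ^ 2 ≤ M ^ 2 * b := by
  rw [norm_div, Complex.norm_real, Real.norm_of_nonneg (Real.sqrt_nonneg b), div_pow,
    Real.sq_sqrt hb]
  rcases hb.eq_or_lt with h | h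
  · simp [← h]
  · rw [div_le_iff₀ h]
    calc ‖B‖ ^ 2 ≤ (M * b) ^ 2 := by gcongr
      _ = _ := by ring

/-- Only zeros of `b` matter. There the quotient is 0 by the convention for division by zero, and
nearby it is at most `√(M² b)`, which tends to 0. -/
lemma continuous_div_sqrt {X : Type*} [TopologicalSpace X] {B : X → ℂ} {b : X → ℝ} {M : ℝ}
    (hBc : Continuous B) (hbc : Continuous b) (hb : ∀ x, 0 ≤ b x) (hB : ∀ x, ‖B x‖ ≤ M * b x) :
    Continuous fun x => B x / (√(b x) : ℝ) := by
  rw [continuous_iff_continuousAt]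
  intro x
  rcases (hb x).eq_or_lt with h | h
  · have h0 : Tendsto (fun y => √(M ^ 2 * b y)) (𝓝 x) (𝓝 0) := by
      have : Continuous fun y => √(M ^ 2 * b y) := by fun_prop
      simpa [← h] using this.tendsto x
    rw [ContinuousAt, ← h, Real.sqrt_zero, Complex.ofReal_zero, div_zero]
    refine squeeze_zero_norm (fun y => ?_) h0
    exact Real.le_sqrt_of_sq_le (sq_norm_div_sqrt_le (hb y) (hB y))
  · refine hBc.continuousAt.div (by fun_prop) ?_
    simpa using (Real.sqrt_pos.2 h).ne'

end DivSqrt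

/-! ### Weighted integrals of nearly constant functions -/

section Weighted

open ComplexConjugate

variable {X : Type*} [TopologicalSpace X] [MeasurableSpace X] [BorelSpace X]

lemma integrable_smul_of_hasCompactSupport {E : Type*} [NormedAddCommGroup E] [NormedSpace ℝ E]
    {μ : Measure X} [IsFiniteMeasureOnCompacts μ] {w : X → ℝ} {φ : X → E} (hw : Continuous w)
    (hφ : Continuous φ) (hφs : HasCompactSupport φ) : Integrable (fun h => w h • φ h) μ :=
  (hw.smul hφ).integrable_of_hasCompactSupport (HasCompactSupport.smul_left (f := w) hφs)

/-- If `f` is nearly constant and `χ = χ' = 1` where the weight `w` lives, the normalised product of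
weighted integrals is close to the weighted integral of the product. -/
lemma norm_mul_conj_div_sqrt_sub_le (μ : Measure X) [IsFiniteMeasureOnCompacts μ]
    [μ.IsOpenPosMeasure] {w : X → ℝ} (hw : Continuous w) (hw0 : ∀ h, 0 ≤ w h) {f f' : X → ℂ}
    {χ χ' : X → ℝ} (hf : Continuous f) (hf' : Continuous f') (hχ : Continuous χ)
    (hfs : HasCompactSupport f) (hf's : HasCompactSupport f') (hχs : HasCompactSupport χ)
    (hχ0 : ∀ h, 0 ≤ χ h) {η : ℝ} (hη : 0 ≤ η) {D : Set X}
    (hfD : ∀ h, f h ≠ 0 → h ∈ D) (hf'D : ∀ h, f' h ≠ 0 → h ∈ D) (hχD : ∀ h, χ h ≠ 0 → h ∈ D)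
    (hχ'D : ∀ h, χ' h ≠ 0 → h ∈ D)
    (hosc : ∀ h ∈ D, ∀ g ∈ D, w h ≠ 0 → w g ≠ 0 → f' h ≠ 0 → ‖f g - f h‖ ≤ η)
    (hone : ∀ h ∈ D, ∀ g ∈ D, w h ≠ 0 → w g ≠ 0 → f h ≠ 0 → χ g = 1)
    (hone' : ∀ h ∈ D, ∀ g ∈ D, w h ≠ 0 → w g ≠ 0 → f' h ≠ 0 → χ' g = 1) :
    ‖(∫ h, w h • f' h ∂μ) / (√(∫ h, w h • χ' h ∂μ) : ℝ)
        * conj ((∫ h, w h • f h ∂μ) / (√(∫ h, w h • χ h ∂μ) : ℝ))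
      - ∫ h, w h • (f' h * conj (f h)) ∂μ‖ ≤ 2 * η * ∫ h, w h • ‖f' h‖ ∂μ := by
  have hrhs : 0 ≤ 2 * η * ∫ h, w h • ‖f' h‖ ∂μ :=
    mul_nonneg (by linarith) (integral_nonneg fun h => mul_nonneg (hw0 h) (norm_nonneg _))
  -- If `f'` or `f` vanishes wherever `w` does not, both compared quantities are 0. Otherwise there
  -- are witnesses `h₀` and `h₁` that activate the hypotheses on `χ'` and `χ`.
  by_cases c1 : ∀ h, w h ≠ 0 → f' h = 0
  · have z1 : ∀ h, w h • f' h = 0 := fun h => by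
      by_cases h0 : w h = 0
      · simp [h0]
      · simp [c1 h h0]
    have z2 : ∀ h, w h • (f' h * conj (f h)) = 0 := fun h => by
      rw [← smul_mul_assoc, z1, zero_mul]
    simp_rw [z1, z2]
    simpa using hrhs
  by_cases c2 : ∀ h, w h ≠ 0 → f h = 0
  · have z1 : ∀ h, w h • f h = 0 := fun h => by
      by_cases h0 : w h = 0
      · simp [h0]
      · simp [c2 h h0]
    have z2 : ∀ h, w h • (f' h * conj (f h)) = 0 := fun h => by
      by_cases h0 : w h = 0
      · simp [h0]
      · simp [c2 h h0]
    simp_rw [z1, z2]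
    simpa using hrhs
  push Not at c1 c2
  obtain ⟨h₀, hw₀, hf₀⟩ := c1
  obtain ⟨h₁, hw₁, hf₁⟩ := c2
  have hD₀ := hf'D h₀ hf₀
  have hD₁ := hfD h₁ hf₁
  -- Where `w ≠ 0`, both cutoffs are 1 on `D` and 0 off `D`. The two square roots therefore coincide
  -- and their product is `a`.
  have hχχ' : ∀ h, w h • χ' h = w h • χ h := fun h => by
    by_cases h0 : w h = 0
    · simp [h0]
    by_cases hD : h ∈ D
    · rw [hone h₁ hD₁ h hD hw₁ h0 hf₁, hone' h₀ hD₀ h hD hw₀ h0 hf₀]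
    · rw [not_imp_comm.1 (hχD h) hD, not_imp_comm.1 (hχ'D h) hD]
  simp_rw [hχχ']
  have iχ : Integrable (fun h => w h • χ h) μ := integrable_smul_of_hasCompactSupport hw hχ hχs
  have if' : Integrable (fun h => w h • f' h) μ := integrable_smul_of_hasCompactSupport hw hf' hf's
  have inf' : Integrable (fun h => w h • ‖f' h‖) μ :=
    integrable_smul_of_hasCompactSupport hw hf'.norm hf's.norm
  have if1 : Integrable (fun h => w h • f h) μ := integrable_smul_of_hasCompactSupport hw hf hfs
  have iff' : Integrable (fun h => w h • (f' h * conj (f h))) μ :=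
    integrable_smul_of_hasCompactSupport hw (hf'.mul (Complex.continuous_conj.comp hf))
      (HasCompactSupport.mul_right (f' := fun h => conj (f h)) hf's)
  set a := ∫ h, w h • χ h ∂μ with ha_def
  have ha : 0 < a := by
    refine (hw.smul hχ).integral_pos_of_hasCompactSupport_nonneg_nonzero (x := h₀)
      (HasCompactSupport.smul_left (f := w) hχs) (fun h => mul_nonneg (hw0 h) (hχ0 h)) ?_
    simp [hw₀, hone h₁ hD₁ h₀ hD₀ hw₁ hw₀ hf₁]
  have d1 : ‖(∫ h, w h • f h ∂μ) - f h₀ * a‖ ≤ η * a := by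
    have : f h₀ * a = ∫ h, f h₀ * ((w h • χ h : ℝ) : ℂ) ∂μ := by
      rw [integral_const_mul, integral_complex_ofReal]
    have iχC : Integrable (fun h => ((w h • χ h : ℝ) : ℂ)) μ := iχ.ofReal
    rw [this, ← integral_sub if1 (iχC.const_mul _), ha_def, ← integral_const_mul]
    refine norm_integral_le_of_norm_le (iχ.const_mul η) (Eventually.of_forall fun h => ?_)
    by_cases h0 : w h = 0
    · simp [h0]
    by_cases hD : h ∈ D
    · have : w h • f h - f h₀ * ((w h • χ h : ℝ) : ℂ) = w h • (f h - f h₀) := by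
        rw [hone h₁ hD₁ h hD hw₁ h0 hf₁]
        simp only [Complex.real_smul, smul_eq_mul, mul_one]
        ring
      rw [this, norm_smul, Real.norm_of_nonneg (hw0 h), hone h₁ hD₁ h hD hw₁ h0 hf₁, smul_eq_mul,
        mul_one, mul_comm]
      exact mul_le_mul_of_nonneg_right (hosc h₀ hD₀ h hD hw₀ h0 hf₀) (hw0 h)
    · simp [not_imp_comm.1 (hχD h) hD, not_imp_comm.1 (hfD h) hD]
  have d2 : ‖(∫ h, w h • (f' h * conj (f h)) ∂μ) - (∫ h, w h • f' h ∂μ) * conj (f h₀)‖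
      ≤ η * ∫ h, w h • ‖f' h‖ ∂μ := by
    rw [← integral_mul_const, ← integral_sub iff' (if'.mul_const _), ← integral_const_mul]
    refine norm_integral_le_of_norm_le (inf'.const_mul η) (Eventually.of_forall fun h => ?_)
    have e : w h • (f' h * conj (f h)) - w h • f' h * conj (f h₀)
        = w h • (f' h * conj (f h - f h₀)) := by
      rw [map_sub]
      simp only [Complex.real_smul]
      ring
    rw [e, norm_smul, Real.norm_of_nonneg (hw0 h), norm_mul, RCLike.norm_conj, smul_eq_mul]
    by_cases h0 : w h = 0
    · simp [h0]
    by_cases hf'0 : f' h = 0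
    · simp [hf'0]
    have := hosc h₀ hD₀ h (hf'D h hf'0) hw₀ h0 hf₀
    calc w h * (‖f' h‖ * ‖f h - f h₀‖) ≤ w h * (‖f' h‖ * η) := by
          gcongr
          exact hw0 h
      _ = _ := by ring
  have d3 : ‖∫ h, w h • f' h ∂μ‖ ≤ ∫ h, w h • ‖f' h‖ ∂μ := by
    refine norm_integral_le_of_norm_le inf' (Eventually.of_forall fun h => ?_)
    rw [norm_smul, Real.norm_of_nonneg (hw0 h), smul_eq_mul]
  set P := ∫ h, w h • f' h ∂μ
  set R := ∫ h, w h • f h ∂μ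
  set S := ∫ h, w h • (f' h * conj (f h)) ∂μ
  set N := ∫ h, w h • ‖f' h‖ ∂μ
  have hsq : ((√a : ℝ) : ℂ) * (√a : ℝ) = a := by
    rw [← Complex.ofReal_mul, Real.mul_self_sqrt ha.le]
  have hane : (a : ℂ) ≠ 0 := by exact_mod_cast ha.ne'
  have hsane : ((√a : ℝ) : ℂ) ≠ 0 := by exact_mod_cast (Real.sqrt_pos.2 ha).ne'
  -- Both `P * conj R / a` and `S` are compared with `P * conj (f h₀)`; each comparison costs `η N`,
  -- whence the factor 2.
  have e : P / (√a : ℝ) * conj (R / (√a : ℝ)) - S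
      = P * conj (R - f h₀ * a) / a - (S - P * conj (f h₀)) := by
    rw [map_div₀, Complex.conj_ofReal, div_mul_div_comm, hsq, map_sub, map_mul, Complex.conj_ofReal]
    field_simp
    ring
  rw [e]
  refine (norm_sub_le _ _).trans ?_
  have d4 : ‖P * conj (R - f h₀ * a) / a‖ ≤ η * N := by
    rw [norm_div, norm_mul, RCLike.norm_conj, Complex.norm_real, Real.norm_of_nonneg ha.le,
      div_le_iff₀ ha]
    calc ‖P‖ * ‖R - f h₀ * a‖ ≤ N * (η * a) :=
          mul_le_mul d3 d1 (norm_nonneg _) ((norm_nonneg _).trans d3)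
      _ = _ := by ring
  linarith

end Weighted

/-! ### Smearing functions on `H` over `G` -/

section Smear

set_option linter.unusedSectionVars false

variable {G H : Type*}
  [Group G] [TopologicalSpace G] [IsTopologicalGroup G] [LocallyCompactSpace G] [T2Space G]
  [MeasurableSpace G] [BorelSpace G]
  [Group H] [TopologicalSpace H] [IsTopologicalGroup H] [LocallyCompactSpace H] [T2Space H]
  [MeasurableSpace H] [BorelSpace H]
  {E : Type*} [NormedAddCommGroup E] [NormedSpace ℝ E]

/-- The convolution `x ↦ ∫ k(ι(h)⁻¹x) φ(h) dh` of the image of `φ` under `ι : H → G` with `k`. -/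
noncomputable def smear (ι : H →ₜ* G) (k : G → ℝ) (φ : H → E) (x : G) : E :=
  ∫ h, k ((ι h)⁻¹ * x) • φ h ∂(haar : Measure H)

variable (ι : H →ₜ* G) {k k' : G → ℝ} {φ : H → E}

lemma continuous_smear_kernel (hk : Continuous k) (hφ : Continuous φ) :
    Continuous fun p : G × H => k ((ι p.2)⁻¹ * p.1) • φ p.2 := by
  have hι : Continuous ι := ι.continuous_toFun
  fun_prop

/-- The shear `(y, h) ↦ (ι(h)y, h)` maps the product of the two supports onto a compact set outside
which the kernel vanishes. -/
lemma hasCompactSupport_smear_kernel (hks : HasCompactSupport k) (hφs : HasCompactSupport φ) :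
    HasCompactSupport fun p : G × H => k ((ι p.2)⁻¹ * p.1) • φ p.2 := by
  have hι : Continuous ι := ι.continuous_toFun
  have hc : Continuous fun p : G × H => (ι p.2 * p.1, p.2) := by fun_prop
  refine HasCompactSupport.intro ((hks.isCompact.prod hφs.isCompact).image hc) fun p hp => ?_
  by_cases h1 : φ p.2 = 0
  · simp [h1]
  by_cases h2 : k ((ι p.2)⁻¹ * p.1) = 0
  · simp [h2]
  exact absurd ⟨((ι p.2)⁻¹ * p.1, p.2), ⟨subset_tsupport _ h2, subset_tsupport _ h1⟩, by simp⟩ hp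

lemma integrable_smear_kernel (hk : Continuous k) (hφ : Continuous φ) (hφs : HasCompactSupport φ)
    (x : G) : Integrable (fun h => k ((ι h)⁻¹ * x) • φ h) (haar : Measure H) := by
  have hι : Continuous ι := ι.continuous_toFun
  exact integrable_smul_of_hasCompactSupport (by fun_prop) hφ hφs

lemma continuous_smear (hk : Continuous k) (hφ : Continuous φ) (hφs : HasCompactSupport φ) :
    Continuous (smear ι k φ) := by
  refine continuousOn_univ.1 (continuousOn_integral_of_compact_support (s := Set.univ)
    (f := fun x h => k ((ι h)⁻¹ * x) • φ h) hφs.isCompact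
    (continuous_smear_kernel ι hk hφ).continuousOn ?_)
  intro x h _ hh
  rw [image_eq_zero_of_notMem_tsupport hh, smul_zero]

lemma hasCompactSupport_smear (hks : HasCompactSupport k) (hφs : HasCompactSupport φ) :
    HasCompactSupport (smear ι k φ) := by
  refine HasCompactSupport.intro
    ((hasCompactSupport_smear_kernel ι hks hφs).isCompact.image continuous_fst) fun x hx => ?_
  refine integral_eq_zero_of_ae (Eventually.of_forall fun h => ?_)
  by_contra h0
  exact hx ⟨(x, h), subset_tsupport _ h0, rfl⟩

/-- Fubini and left invariance. For a density `k`, integrals over `H` thus become integrals over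
`G`. -/
lemma integral_smear [CompleteSpace E] (hk : Continuous k) (hks : HasCompactSupport k)
    (hφ : Continuous φ) (hφs : HasCompactSupport φ) :
    ∫ x, smear ι k φ x ∂(haar : Measure G)
      = (∫ x, k x ∂(haar : Measure G)) • ∫ h, φ h ∂(haar : Measure H) := by
  unfold smear
  rw [integral_integral_swap_of_hasCompactSupport
    (f := fun (x : G) (h : H) => k ((ι h)⁻¹ * x) • φ h) (continuous_smear_kernel ι hk hφ)
    (hasCompactSupport_smear_kernel ι hks hφs), ← integral_smul]
  refine integral_congr_ae (Eventually.of_forall fun h => ?_)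
  dsimp only
  rw [integral_smul_const, integral_mul_left_eq_self (μ := (haar : Measure G)) k (ι h)⁻¹]

lemma norm_smear_le (hk : Continuous k) (hk0 : ∀ x, 0 ≤ k x) {ψ : H → ℝ} (hψ : Continuous ψ)
    (hψs : HasCompactSupport ψ) (h : ∀ g, ‖φ g‖ ≤ ψ g) (x : G) :
    ‖smear ι k φ x‖ ≤ smear ι k ψ x := by
  refine norm_integral_le_of_norm_le (integrable_smear_kernel ι hk hψ hψs x)
    (Eventually.of_forall fun g => ?_)
  rw [norm_smul, Real.norm_of_nonneg (hk0 _)]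
  exact mul_le_mul_of_nonneg_left (h g) (hk0 _)

lemma smear_nonneg (hk0 : ∀ x, 0 ≤ k x) {ψ : H → ℝ} (hψ : ∀ h, 0 ≤ ψ h) (x : G) :
    0 ≤ smear ι k ψ x :=
  integral_nonneg fun h => mul_nonneg (hk0 _) (hψ h)

/-- The integrand is dominated by the smearing of `‖φ‖` with the kernel `|k - k'|`, to which
`integral_smear` applies. -/
lemma integral_norm_smear_sub_le (hk : Continuous k) (hks : HasCompactSupport k)
    (hk' : Continuous k') (hks' : HasCompactSupport k') (hφ : Continuous φ)
    (hφs : HasCompactSupport φ) :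
    ∫ x, ‖smear ι k φ x - smear ι k' φ x‖ ∂(haar : Measure G)
      ≤ (∫ x, |k x - k' x| ∂(haar : Measure G)) * ∫ h, ‖φ h‖ ∂(haar : Measure H) := by
  have hd : Continuous fun x => |k x - k' x| := (hk.sub hk').abs
  have hds : HasCompactSupport fun x => |k x - k' x| := (hks.sub hks').norm
  rw [← smul_eq_mul, ← integral_smear ι hd hds hφ.norm hφs.norm]
  refine integral_mono_of_nonneg (Eventually.of_forall fun x => norm_nonneg _)
    ((continuous_smear ι hd hφ.norm hφs.norm).integrable_of_hasCompactSupport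
      (hasCompactSupport_smear ι hds hφs.norm)) (Eventually.of_forall fun x => ?_)
  dsimp only
  unfold smear
  rw [← integral_sub (integrable_smear_kernel ι hk hφ hφs x)
    (integrable_smear_kernel ι hk' hφ hφs x)]
  refine norm_integral_le_of_norm_le (integrable_smear_kernel ι hd hφ.norm hφs.norm x)
    (Eventually.of_forall fun h => ?_)
  rw [← sub_smul, norm_smul, Real.norm_eq_abs, smul_eq_mul]

lemma integral_comp_mul_left_mul_right (φ : H → E) (s t : H) :
    ∫ h, φ (s * h * t) ∂(haar : Measure H)
      = (modularFunction t : ℝ)⁻¹ • ∫ h, φ h ∂(haar : Measure H) := by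
  rw [integral_mul_left_eq_self (μ := (haar : Measure H)) (fun h => φ (h * t)) s]
  have := (Homeomorph.mulRight t).toMeasurableEquiv.measurableEmbedding.integral_map
    (μ := (haar : Measure H)) φ
  change ∫ h, φ h ∂(Measure.map (· * t) haar) = ∫ h, φ (h * t) ∂(haar : Measure H) at this
  rw [← this, map_mul_right_haar, integral_smul_nnreal_measure]
  rfl

/-- Translates of `smear` are multiples of `smear` of the conjugated kernel. -/
lemma smear_translate (k : G → ℝ) (φ : H → E) (s t : H) (x : G) :
    smear ι k φ ((ι s)⁻¹ * x * ι t) = ((modularFunction t : ℝ) / modularFunction (ι t)) •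
      smear ι (fun y => (modularFunction (ι t) : ℝ) * k ((ι t)⁻¹ * y * ι t))
        (fun h => φ (s⁻¹ * h * t)) x := by
  have h1 : (modularFunction t : ℝ) ≠ 0 := (NNReal.coe_pos.2 (modularFunction_pos t)).ne'
  have h2 : (modularFunction (ι t) : ℝ) ≠ 0 := (NNReal.coe_pos.2 (modularFunction_pos (ι t))).ne'
  -- The substitution `h ↦ s⁻¹ht` turns `ι(h)⁻¹ι(s)⁻¹xι(t)` into `ι(t)⁻¹(ι(h)⁻¹x)ι(t)`: `s` cancels
  -- and `t` acts on the kernel by conjugation.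
  have h3 := integral_comp_mul_left_mul_right
    (fun h => k ((ι h)⁻¹ * ((ι s)⁻¹ * x * ι t)) • φ h) s⁻¹ t
  unfold smear
  rw [← smul_inv_smul₀ h1 (∫ h, k ((ι h)⁻¹ * ((ι s)⁻¹ * x * ι t)) • φ h ∂(haar : Measure H)), ← h3,
    div_eq_mul_inv, mul_smul, ← integral_smul (modularFunction (ι t) : ℝ)⁻¹]
  congr 2
  funext h
  rw [smul_smul, inv_mul_cancel_left₀ h2]
  congr 2
  simp only [map_mul, map_inv]
  group

end Smear

/-! ### Transferred functions and translation -/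

section Transfer

set_option linter.unusedSectionVars false

open ComplexConjugate

variable {G H : Type*}
  [Group G] [TopologicalSpace G] [IsTopologicalGroup G] [LocallyCompactSpace G] [T2Space G]
  [MeasurableSpace G] [BorelSpace G]
  [Group H] [TopologicalSpace H] [IsTopologicalGroup H] [LocallyCompactSpace H] [T2Space H]
  [MeasurableSpace H] [BorelSpace H]

/-- The function `(f * k) / √(χ * k)` on `G` attached to `f` on `H`. -/
noncomputable def transfer (ι : H →ₜ* G) (k : G → ℝ) (f : H → ℂ) (χ : H → ℝ) (x : G) : ℂ :=
  smear ι k f x / (√(smear ι k χ x) : ℝ)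

lemma hasCompactSupport_translate {E : Type*} [Zero E] {φ : G → E} (hφ : HasCompactSupport φ)
    (s t : G) : HasCompactSupport fun h => φ (s⁻¹ * h * t) :=
  hφ.comp_homeomorph ((Homeomorph.mulLeft s⁻¹).trans (Homeomorph.mulRight t))

variable (ι : H →ₜ* G) {k : G → ℝ} {f : H → ℂ} {χ : H → ℝ} {M : ℝ}

lemma norm_smear_le_mul (hk : Continuous k) (hk0 : ∀ x, 0 ≤ k x) (hχ : Continuous χ)
    (hχs : HasCompactSupport χ) (hfχ : ∀ h, ‖f h‖ ≤ M * χ h) (x : G) :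
    ‖smear ι k f x‖ ≤ M * smear ι k χ x := by
  refine (norm_smear_le ι hk hk0 (hχ.const_mul M) hχs.mul_left hfχ x).trans_eq ?_
  unfold smear
  rw [← integral_const_mul]
  exact integral_congr_ae (Eventually.of_forall fun h => mul_left_comm _ _ _)

lemma continuous_transfer (hk : Continuous k) (hk0 : ∀ x, 0 ≤ k x) (hf : Continuous f)
    (hfs : HasCompactSupport f) (hχ : Continuous χ) (hχs : HasCompactSupport χ)
    (hχ0 : ∀ h, 0 ≤ χ h) (hfχ : ∀ h, ‖f h‖ ≤ M * χ h) : Continuous (transfer ι k f χ) := by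
  refine continuous_div_sqrt (M := M) (continuous_smear ι hk hf hfs) (continuous_smear ι hk hχ hχs)
    (smear_nonneg ι hk0 hχ0) (norm_smear_le_mul ι hk hk0 hχ hχs hfχ)

lemma hasCompactSupport_transfer (hks : HasCompactSupport k) (hfs : HasCompactSupport f) :
    HasCompactSupport (transfer ι k f χ) :=
  (hasCompactSupport_smear ι hks hfs).mono fun x hx h => hx (by simp [transfer, h])

/-- With `r = Δ_H(t) / Δ_G(ι(t))`, the numerator acquires the factor `r` and the denominator `√r`.
The remaining `√r` is exactly the ratio of the `L²` normalisations on `H` and `G`, so the two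
modular functions need not be related. -/
lemma transfer_translate (k : G → ℝ) (f : H → ℂ) (χ : H → ℝ) (s t : H) (x : G) :
    (√(modularFunction (ι t) : ℝ) : ℂ) * transfer ι k f χ ((ι s)⁻¹ * x * ι t)
      = (√(modularFunction t : ℝ) : ℂ) *
        transfer ι (fun y => (modularFunction (ι t) : ℝ) * k ((ι t)⁻¹ * y * ι t))
          (fun h => f (s⁻¹ * h * t)) (fun h => χ (s⁻¹ * h * t)) x := by
  have h1 : 0 < (modularFunction t : ℝ) := NNReal.coe_pos.2 (modularFunction_pos t)
  have h2 : 0 < (modularFunction (ι t) : ℝ) := NNReal.coe_pos.2 (modularFunction_pos (ι t))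
  unfold transfer
  rw [smear_translate, smear_translate, smul_eq_mul, Real.sqrt_mul (by positivity),
    Complex.real_smul, Complex.ofReal_mul]
  set r := (modularFunction t : ℝ) / modularFunction (ι t) with hr
  have hrpos : 0 < r := div_pos h1 h2
  have e1 : ((r : ℝ) : ℂ) = (√r : ℝ) * (√r : ℝ) := by
    rw [← Complex.ofReal_mul, Real.mul_self_sqrt hrpos.le]
  have e2 : (√(modularFunction t : ℝ) : ℂ) = (√(modularFunction (ι t) : ℝ) : ℂ) * (√r : ℝ) := by
    rw [← Complex.ofReal_mul, ← Real.sqrt_mul h2.le, hr, mul_div_cancel₀ _ h2.ne']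
  have e3 : ((√r : ℝ) : ℂ) ≠ 0 := by exact_mod_cast (Real.sqrt_pos.2 hrpos).ne'
  rw [e1, e2, mul_assoc ((√r : ℝ) : ℂ), mul_div_mul_left _ _ e3]
  ring

/-- Translating `transfer f` and transferring the translate of `f` give nearby functions if the
kernel is nearly invariant under conjugation. -/
lemma norm_integral_translate_sub_le (hk : Continuous k) (hks : HasCompactSupport k)
    (hk0 : ∀ x, 0 ≤ k x) (hk1 : ∫ x, k x ∂(haar : Measure G) = 1) (hf : Continuous f)
    (hfs : HasCompactSupport f) (hχ : Continuous χ) (hχs : HasCompactSupport χ)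
    (hχ0 : ∀ h, 0 ≤ χ h) (hM : 0 ≤ M) (hfχ : ∀ h, ‖f h‖ ≤ M * χ h) (s t : H) {δ κ : ℝ}
    (hδ : ∫ x, |(modularFunction (ι t) : ℝ) * k ((ι t)⁻¹ * x * ι t) - k x| ∂(haar : Measure G) ≤ δ)
    (hκ : 0 < κ) :
    ‖(∫ x, (√(modularFunction (ι t) : ℝ) : ℂ) * transfer ι k f χ ((ι s)⁻¹ * x * ι t)
          * conj (transfer ι k f χ x) ∂(haar : Measure G))
      - ∫ x, (√(modularFunction t : ℝ) : ℂ) *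
          transfer ι k (fun h => f (s⁻¹ * h * t)) (fun h => χ (s⁻¹ * h * t)) x
          * conj (transfer ι k f χ x) ∂(haar : Measure G)‖
      ≤ (δ * (4 * M * (∫ h, ‖f h‖ ∂(haar : Measure H)) + 6 * M ^ 2 * ∫ h, χ h ∂(haar : Measure H)) / κ
        + κ * (M ^ 2 * ∫ h, χ h ∂(haar : Measure H))) / 2 := by
  have ht : 0 < (modularFunction t : ℝ) := NNReal.coe_pos.2 (modularFunction_pos t)
  simp_rw [transfer_translate]
  set kt : G → ℝ := fun y => (modularFunction (ι t) : ℝ) * k ((ι t)⁻¹ * y * ι t) with hkt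
  set f' : H → ℂ := fun h => f (s⁻¹ * h * t) with hf'def
  set χ' : H → ℝ := fun h => χ (s⁻¹ * h * t) with hχ'def
  set c : ℝ := √(modularFunction t : ℝ) with hc
  have hc2 : c ^ 2 = modularFunction t := Real.sq_sqrt ht.le
  have hktc : Continuous kt := by fun_prop
  have hkts : HasCompactSupport kt := (hasCompactSupport_translate hks (ι t) (ι t)).mul_left
  have hkt0 : ∀ x, 0 ≤ kt x := fun x => mul_nonneg (NNReal.coe_nonneg _) (hk0 _)
  have hf' : Continuous f' := by fun_prop
  have hf's : HasCompactSupport f' := hasCompactSupport_translate hfs s t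
  have hχ' : Continuous χ' := by fun_prop
  have hχ's : HasCompactSupport χ' := hasCompactSupport_translate hχs s t
  have hχ'0 : ∀ h, 0 ≤ χ' h := fun h => hχ0 _
  have hfχ' : ∀ h, ‖f' h‖ ≤ M * χ' h := fun h => hfχ _
  have cF := continuous_transfer ι hk hk0 hf hfs hχ hχs hχ0 hfχ
  have sF := hasCompactSupport_transfer ι (χ := χ) hks hfs
  have cX := continuous_transfer ι hk hk0 hf' hf's hχ' hχ's hχ'0 hfχ'
  have cXt := continuous_transfer ι hktc hkt0 hf' hf's hχ' hχ's hχ'0 hfχ'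
  have cconj := Complex.continuous_conj.comp cF
  have sconj : HasCompactSupport fun x => conj (transfer ι k f χ x) := by
    refine sF.mono fun x hx h => hx (by simp [h])
  have i1 : Integrable (fun x => (c : ℂ) * transfer ι kt f' χ' x * conj (transfer ι k f χ x))
      (haar : Measure G) :=
    ((continuous_const.mul cXt).mul cconj).integrable_of_hasCompactSupport
      (HasCompactSupport.mul_left (f := fun x => (c : ℂ) * transfer ι kt f' χ' x) sconj)
  have i2 : Integrable (fun x => (c : ℂ) * transfer ι k f' χ' x * conj (transfer ι k f χ x))
      (haar : Measure G) :=
    ((continuous_const.mul cX).mul cconj).integrable_of_hasCompactSupport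
      (HasCompactSupport.mul_left (f := fun x => (c : ℂ) * transfer ι k f' χ' x) sconj)
  have j1 : Integrable (fun x => ‖smear ι kt f' x - smear ι k f' x‖) (haar : Measure G) :=
    (((continuous_smear ι hktc hf' hf's).integrable_of_hasCompactSupport
      (hasCompactSupport_smear ι hkts hf's)).sub
      ((continuous_smear ι hk hf' hf's).integrable_of_hasCompactSupport
      (hasCompactSupport_smear ι hks hf's))).norm
  have j2 : Integrable (fun x => ‖smear ι kt χ' x - smear ι k χ' x‖) (haar : Measure G) :=
    (((continuous_smear ι hktc hχ' hχ's).integrable_of_hasCompactSupport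
      (hasCompactSupport_smear ι hkts hχ's)).sub
      ((continuous_smear ι hk hχ' hχ's).integrable_of_hasCompactSupport
      (hasCompactSupport_smear ι hks hχ's))).norm
  have j3 : Integrable (smear ι k χ) (haar : Measure G) :=
    (continuous_smear ι hk hχ hχs).integrable_of_hasCompactSupport
      (hasCompactSupport_smear ι hks hχs)
  -- The factor `Δ(t)⁻¹` from the translate of `f` is later cancelled by `c² = Δ(t)`, so the final
  -- bound does not depend on `s`, and on `t` only through `δ`.
  have b1 : ∫ x, ‖smear ι kt f' x - smear ι k f' x‖ ∂(haar : Measure G)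
      ≤ δ * ((modularFunction t : ℝ)⁻¹ * ∫ h, ‖f h‖ ∂(haar : Measure H)) := by
    refine (integral_norm_smear_sub_le ι hktc hkts hk hks hf' hf's).trans ?_
    have := integral_comp_mul_left_mul_right (fun h => ‖f h‖) s⁻¹ t
    rw [smul_eq_mul] at this
    rw [this]
    exact mul_le_mul_of_nonneg_right hδ
      (mul_nonneg (inv_nonneg.2 ht.le) (integral_nonneg fun _ => norm_nonneg _))
  have b2 : ∫ x, ‖smear ι kt χ' x - smear ι k χ' x‖ ∂(haar : Measure G)
      ≤ δ * ((modularFunction t : ℝ)⁻¹ * ∫ h, χ h ∂(haar : Measure H)) := by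
    refine (integral_norm_smear_sub_le ι hktc hkts hk hks hχ' hχ's).trans ?_
    have := integral_comp_mul_left_mul_right (fun h => ‖χ h‖) s⁻¹ t
    rw [smul_eq_mul] at this
    rw [this]
    simp_rw [Real.norm_of_nonneg (hχ0 _)]
    exact mul_le_mul_of_nonneg_right hδ
      (mul_nonneg (inv_nonneg.2 ht.le) (integral_nonneg hχ0))
  have b3 : ∫ x, smear ι k χ x ∂(haar : Measure G) = ∫ h, χ h ∂(haar : Measure H) := by
    rw [integral_smear ι hk hks hχ hχs, hk1, one_smul]
  rw [← integral_sub i1 i2]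
  have ibound : Integrable (fun x => (c ^ 2 * (4 * M * ‖smear ι kt f' x - smear ι k f' x‖
      + 6 * M ^ 2 * ‖smear ι kt χ' x - smear ι k χ' x‖) / κ
      + κ * (M ^ 2 * smear ι k χ x)) / 2) (haar : Measure G) :=
    (((((j1.const_mul (4 * M)).add (j2.const_mul (6 * M ^ 2))).const_mul (c ^ 2)).div_const κ).add
      ((j3.const_mul (M ^ 2)).const_mul κ)).div_const 2
  refine (norm_integral_le_of_norm_le ibound (Eventually.of_forall fun x => ?_)).trans ?_
  · have p1 := sq_norm_div_sqrt_sub_le (smear_nonneg ι hkt0 hχ'0 x) (smear_nonneg ι hk0 hχ'0 x)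
      (norm_smear_le_mul ι hktc hkt0 hχ' hχ's hfχ' x) (norm_smear_le_mul ι hk hk0 hχ' hχ's hfχ' x) hM
    have p2 := sq_norm_div_sqrt_le (smear_nonneg ι hk0 hχ0 x)
      (norm_smear_le_mul ι hk hk0 hχ hχs hfχ x)
    change ‖transfer ι kt f' χ' x - transfer ι k f' χ' x‖ ^ 2 ≤ _ at p1
    change ‖transfer ι k f χ x‖ ^ 2 ≤ _ at p2
    rw [← sub_mul, ← mul_sub, norm_mul, norm_mul, RCLike.norm_conj, Complex.norm_real,
      Real.norm_of_nonneg (Real.sqrt_nonneg _)]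
    set u := ‖transfer ι kt f' χ' x - transfer ι k f' χ' x‖
    set v := ‖transfer ι k f χ x‖
    -- A pointwise weighted arithmetic-geometric mean inequality in place of Cauchy–Schwarz: `u²` is
    -- small in `L¹`, while `v²` is only bounded there and is made harmless by a small `κ`.
    have q1 : c * u * v ≤ (c ^ 2 * u ^ 2 / κ + κ * v ^ 2) / 2 := by
      have : 0 ≤ (c * u - κ * v) ^ 2 / κ := by positivity
      have e : (c * u - κ * v) ^ 2 / κ = c ^ 2 * u ^ 2 / κ + κ * v ^ 2 - 2 * (c * u * v) := by
        field_simp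
        ring
      linarith
    refine q1.trans ?_
    rw [Real.norm_eq_abs (smear ι kt χ' x - smear ι k χ' x)]
    gcongr
  · rw [integral_div, integral_add, integral_div, integral_const_mul, integral_add,
      integral_const_mul, integral_const_mul, integral_const_mul, integral_const_mul, b3, hc2]
    · have : (modularFunction t : ℝ) * (4 * M * (δ * ((modularFunction t : ℝ)⁻¹ *
          ∫ h, ‖f h‖ ∂(haar : Measure H)))
          + 6 * M ^ 2 * (δ * ((modularFunction t : ℝ)⁻¹ * ∫ h, χ h ∂(haar : Measure H))))
          = δ * (4 * M * (∫ h, ‖f h‖ ∂(haar : Measure H))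
            + 6 * M ^ 2 * ∫ h, χ h ∂(haar : Measure H)) := by
        field_simp
      rw [← this]
      gcongr
    · exact j1.const_mul _
    · exact j2.const_mul _
    · exact (((j1.const_mul (4 * M)).add (j2.const_mul (6 * M ^ 2))).const_mul (c ^ 2)).div_const κ
    · exact (j3.const_mul (M ^ 2)).const_mul κ

end Transfer

/-! ### Approximating coefficients at functions in `C_c(H)` -/

section Approximation

set_option linter.unusedSectionVars false

open ComplexConjugate Pointwise

variable {G H : Type*}
  [Group G] [TopologicalSpace G] [IsTopologicalGroup G] [LocallyCompactSpace G] [T2Space G]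
  [MeasurableSpace G] [BorelSpace G]
  [Group H] [TopologicalSpace H] [IsTopologicalGroup H] [LocallyCompactSpace H] [T2Space H]
  [MeasurableSpace H] [BorelSpace H]

variable (ι : H →ₜ* G) {k : G → ℝ} {f : H → ℂ} {χ : H → ℝ} {M : ℝ}

/-- For a kernel supported near the identity, the inner product of two transferred functions is
close to the inner product of the original ones. -/
lemma norm_integral_transfer_sub_le (hk : Continuous k) (hks : HasCompactSupport k)
    (hk0 : ∀ x, 0 ≤ k x) (hk1 : ∫ x, k x ∂(haar : Measure G) = 1) (hf : Continuous f)
    (hfs : HasCompactSupport f) (hχ : Continuous χ) (hχs : HasCompactSupport χ)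
    (hχ0 : ∀ h, 0 ≤ χ h) (hfχ : ∀ h, ‖f h‖ ≤ M * χ h) (s t : H) {η : ℝ} (hη : 0 ≤ η)
    {D : Set H} (hχD : ∀ h, χ h ≠ 0 → h ∈ D) (hχ'D : ∀ h, χ (s⁻¹ * h * t) ≠ 0 → h ∈ D)
    (hnear : ∀ h ∈ D, ∀ g ∈ D, ∀ x, k ((ι h)⁻¹ * x) ≠ 0 → k ((ι g)⁻¹ * x) ≠ 0 →
      ‖f g - f h‖ ≤ η ∧ (f h ≠ 0 → χ g = 1) ∧
        (f (s⁻¹ * h * t) ≠ 0 → χ (s⁻¹ * g * t) = 1)) :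
    ‖(∫ x, (√(modularFunction t : ℝ) : ℂ) *
          transfer ι k (fun h => f (s⁻¹ * h * t)) (fun h => χ (s⁻¹ * h * t)) x
          * conj (transfer ι k f χ x) ∂(haar : Measure G))
      - ∫ h, (√(modularFunction t : ℝ) : ℂ) * f (s⁻¹ * h * t) * conj (f h) ∂(haar : Measure H)‖
      ≤ √(modularFunction t : ℝ) * (2 * η * ((modularFunction t : ℝ)⁻¹ *
          ∫ h, ‖f h‖ ∂(haar : Measure H))) := by
  set f' : H → ℂ := fun h => f (s⁻¹ * h * t) with hf'def
  set χ' : H → ℝ := fun h => χ (s⁻¹ * h * t) with hχ'def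
  have hf' : Continuous f' := by fun_prop
  have hf's : HasCompactSupport f' := hasCompactSupport_translate hfs s t
  have hχ' : Continuous χ' := by fun_prop
  have hχ's : HasCompactSupport χ' := hasCompactSupport_translate hχs s t
  have hχ'0 : ∀ h, 0 ≤ χ' h := fun h => hχ0 _
  have hfχ' : ∀ h, ‖f' h‖ ≤ M * χ' h := fun h => hfχ _
  have hfχ0 : ∀ h, f h ≠ 0 → χ h ≠ 0 := fun h h1 h2 => h1 (by simpa [h2] using hfχ h)
  have cconj := Complex.continuous_conj.comp
    (continuous_transfer ι hk hk0 hf hfs hχ hχs hχ0 hfχ)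
  have i1 : Integrable (fun x => transfer ι k f' χ' x * conj (transfer ι k f χ x))
      (haar : Measure G) :=
    ((continuous_transfer ι hk hk0 hf' hf's hχ' hχ's hχ'0 hfχ').mul
      cconj).integrable_of_hasCompactSupport
      (HasCompactSupport.mul_right (f' := fun x => conj (transfer ι k f χ x))
        (hasCompactSupport_transfer ι hks hf's))
  have hp : Continuous fun h => f' h * conj (f h) := hf'.mul (Complex.continuous_conj.comp hf)
  have hps : HasCompactSupport fun h => f' h * conj (f h) :=
    HasCompactSupport.mul_right (f' := fun h => conj (f h)) hf's
  have i2 : Integrable (smear ι k fun h => f' h * conj (f h)) (haar : Measure G) :=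
    (continuous_smear ι hk hp hps).integrable_of_hasCompactSupport
      (hasCompactSupport_smear ι hks hps)
  have i3 : Integrable (smear ι k fun h => ‖f' h‖) (haar : Measure G) :=
    (continuous_smear ι hk hf'.norm hf's.norm).integrable_of_hasCompactSupport
      (hasCompactSupport_smear ι hks hf's.norm)
  -- As `∫ k = 1`, the inner product over `H` becomes an integral over `G`, and the integrands can
  -- be compared at each `x`, with weight `k(ι(h)⁻¹x)`.
  have e1 : ∫ h, f' h * conj (f h) ∂(haar : Measure H)
      = ∫ x, smear ι k (fun h => f' h * conj (f h)) x ∂(haar : Measure G) := by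
    rw [integral_smear ι hk hks hp hps, hk1, one_smul]
  have e2 : (modularFunction t : ℝ)⁻¹ * ∫ h, ‖f h‖ ∂(haar : Measure H)
      = ∫ x, smear ι k (fun h => ‖f' h‖) x ∂(haar : Measure G) := by
    rw [integral_smear ι hk hks hf'.norm hf's.norm, hk1, one_smul]
    exact (integral_comp_mul_left_mul_right (fun h => ‖f h‖) s⁻¹ t).symm
  simp_rw [mul_assoc (√(modularFunction t : ℝ) : ℂ)]
  rw [integral_const_mul, integral_const_mul, ← mul_sub, norm_mul, Complex.norm_real,
    Real.norm_of_nonneg (Real.sqrt_nonneg _), e1, e2, ← integral_sub i1 i2, ← integral_const_mul]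
  refine mul_le_mul_of_nonneg_left ?_ (Real.sqrt_nonneg _)
  refine norm_integral_le_of_norm_le (i3.const_mul _) (Eventually.of_forall fun x => ?_)
  have hι : Continuous ι := ι.continuous_toFun
  exact norm_mul_conj_div_sqrt_sub_le (haar : Measure H) (w := fun h => k ((ι h)⁻¹ * x))
    (by fun_prop) (fun h => hk0 _) hf hf' hχ hfs hf's hχs hχ0 hη (D := D)
    (fun h hh => hχD h (hfχ0 h hh)) (fun h hh => hχ'D h (hfχ0 _ hh)) hχD hχ'D
    (fun h hh g hg wh wg _ => (hnear h hh g hg x wh wg).1)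
    (fun h hh g hg wh wg => (hnear h hh g hg x wh wg).2.1)
    (fun h hh g hg wh wg => (hnear h hh g hg x wh wg).2.2)

/-- An injective continuous homomorphism is a homeomorphism on compact sets: points of a compact
set with nearby images are nearby. -/
lemma exists_nhds_inv_mul_mem (hι : Function.Injective ι) {D N : Set H} (hD : IsCompact D)
    (hN : N ∈ 𝓝 1) : ∃ U ∈ 𝓝 (1 : G), ∀ h ∈ D, ∀ g ∈ D, ∀ x : G,
      (ι h)⁻¹ * x ∈ U → (ι g)⁻¹ * x ∈ U → h⁻¹ * g ∈ N := by
  -- The bad quotients `h⁻¹g` form a compact set without 1, so by injectivity their image is closed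
  -- and misses 1. If `U U⁻¹` avoids that image, `U` works, because `ι(h)⁻¹x (ι(g)⁻¹x)⁻¹ = ι(h⁻¹g)`.
  have hC : IsCompact (ι '' ((D⁻¹ * D) \ interior N)) :=
    ((hD.inv.mul hD).diff isOpen_interior).image ι.continuous_toFun
  have h1 : (ι '' ((D⁻¹ * D) \ interior N))ᶜ ∈ 𝓝 (1 : G) := by
    refine hC.isClosed.isOpen_compl.mem_nhds ?_
    rintro ⟨h, ⟨-, hh⟩, h1⟩
    have : h = 1 := hι (h1.trans (map_one ι).symm)
    exact hh (this ▸ mem_interior_iff_mem_nhds.2 hN)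
  obtain ⟨U, hU, hUC⟩ := exists_nhds_split_inv h1
  refine ⟨U, hU, fun h hh g hg x hx gx => ?_⟩
  by_contra hN'
  refine hUC _ hx _ gx ⟨h⁻¹ * g, ⟨Set.mul_mem_mul (Set.inv_mem_inv.2 hh) hg,
    fun hi => hN' (interior_subset hi)⟩, ?_⟩
  simp [div_eq_mul_inv]

/-- Diagonal coefficients of `λ_H·ρ_H` at functions in `C_c(H)` are approximated by coefficients of
`λ_G·ρ_G`, in terms of integrals. -/
theorem exists_coefficient_approx {G : Type u} [Group G] [TopologicalSpace G]
    [IsTopologicalGroup G] [LocallyCompactSpace G] [T2Space G] [MeasurableSpace G] [BorelSpace G]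
    (hG : IsQSIN G) (ι : H →ₜ* G) (hι : Function.Injective ι)
    (hf : Continuous f) (hfs : HasCompactSupport f) {Q : Set (H × H)} (hQ : IsCompact Q) {ε : ℝ}
    (hε : 0 < ε) : ∃ F : G → ℂ, Continuous F ∧ HasCompactSupport F ∧ ∀ p ∈ Q,
      ‖(∫ h, (√(modularFunction p.2 : ℝ) : ℂ) * f (p.1⁻¹ * h * p.2) * conj (f h)
          ∂(haar : Measure H))
        - ∫ x, (√(modularFunction (ι p.2) : ℝ) : ℂ) * F ((ι p.1)⁻¹ * x * ι p.2) * conj (F x)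
          ∂(haar : Measure G)‖ < ε := by
  have hQ₁ : IsCompact (Prod.fst '' Q) := hQ.image continuous_fst
  have hQ₂ : IsCompact (Prod.snd '' Q) := hQ.image continuous_snd
  obtain ⟨V, hVc, hV⟩ := exists_compact_mem_nhds (1 : H)
  have hV1 : (1 : H) ∈ V := mem_of_mem_nhds hV
  obtain ⟨χ, hχ1, -, hχs, hχ⟩ := exists_continuous_one_zero_of_isCompact
    (hfs.isCompact.mul hVc) isClosed_empty (Set.disjoint_empty _)
  obtain ⟨M, hM⟩ := hfs.exists_bound_of_continuous hf
  have hM0 : 0 ≤ M := (norm_nonneg _).trans (hM 1)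
  have hfχ : ∀ h, ‖f h‖ ≤ M * χ h := fun h => by
    by_cases h0 : f h = 0
    · rw [h0, norm_zero]
      exact mul_nonneg hM0 (hχ h).1
    · have : χ h = 1 := hχ1 ⟨h, subset_tsupport _ h0, 1, hV1, mul_one h⟩
      rw [this, mul_one]
      exact hM h
  have hχ0 : ∀ h, 0 ≤ χ h := fun h => (hχ h).1
  -- A compact set containing the supports of `χ` and of all its translates `h ↦ χ(s⁻¹ht)` with `(s,
  -- t) ∈ Q`.
  set D : Set H := tsupport χ ∪ Prod.fst '' Q * tsupport χ * (Prod.snd '' Q)⁻¹ with hDdef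
  have hD : IsCompact D := hχs.isCompact.union ((hQ₁.mul hχs.isCompact).mul hQ₂.inv)
  obtain ⟨C, hC⟩ := hQ₂.exists_bound_of_continuousOn
    (f := fun t : H => √(modularFunction t : ℝ) * (modularFunction t : ℝ)⁻¹) (by
      have h1 : Continuous fun t : H => (modularFunction t : ℝ) :=
        NNReal.continuous_coe.comp continuous_modularFunction
      exact (h1.sqrt.mul (h1.inv₀ fun t =>
        (NNReal.coe_pos.2 (modularFunction_pos t)).ne')).continuousOn)
  set I := ∫ h, ‖f h‖ ∂(haar : Measure H) with hI
  set J := ∫ h, χ h ∂(haar : Measure H) with hJ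
  have hI0 : 0 ≤ I := integral_nonneg fun h => norm_nonneg _
  have hJ0 : 0 ≤ J := integral_nonneg hχ0
  set B := 4 * M * I + 6 * M ^ 2 * J with hB
  have hB0 : 0 ≤ B := by positivity
  -- `κ` must precede `δ`, which has to absorb `1/κ`. Changing the kernel then costs at most `ε/2`
  -- and comparing inner products at most `ε/4`, in all `3ε/4`.
  set κ := ε / (2 * (M ^ 2 * J + 1)) with hκdef
  have hκ : 0 < κ := by positivity
  have hκε : κ * (M ^ 2 * J) ≤ ε / 2 := by
    rw [hκdef, div_mul_eq_mul_div, div_le_div_iff₀ (by positivity) (by positivity)]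
    nlinarith
  set δ := κ * ε / (2 * (B + 1)) with hδdef
  have hδ : 0 < δ := by positivity
  have hδε : δ * B / κ ≤ ε / 2 := by
    have : δ * B / κ = ε * B / (2 * (B + 1)) := by
      rw [hδdef]; field_simp
    rw [this, div_le_div_iff₀ (by positivity) (by positivity)]
    nlinarith
  set η := ε / (8 * (|C| * I + 1)) with hηdef
  have hη : 0 < η := by positivity
  have hηε : |C| * (2 * η * I) ≤ ε / 4 := by
    have : |C| * (2 * η * I) = 2 * ε * (|C| * I) / (8 * (|C| * I + 1)) := by
      rw [hηdef]; ring
    rw [this, div_le_div_iff₀ (by positivity) (by positivity)]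
    nlinarith
  -- To be used with `n = h⁻¹g`. The last condition serves the translated cutoff, as `s⁻¹gt =
  -- (s⁻¹ht)(t⁻¹nt)`.
  have hN : ∀ᶠ n in 𝓝 (1 : H), (∀ h ∈ D, ‖f (h * n) - f h‖ < η) ∧ n ∈ V ∧
      ∀ t ∈ Prod.snd '' Q, t⁻¹ * n * t ∈ V := by
    refine (hD.eventually_forall_of_forall_eventually
      (P := fun n h => ‖f (h * n) - f h‖ < η) fun h _ => ?_).and
      ((eventually_mem_set.2 hV).and (hQ₂.eventually_forall_of_forall_eventually
      (P := fun n t => t⁻¹ * n * t ∈ V) fun t _ => ?_))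
    · have h1 : Continuous fun z : H × H => ‖f (z.2 * z.1) - f z.2‖ := by fun_prop
      exact h1.continuousAt.eventually (gt_mem_nhds (by simpa using hη))
    · have h1 : Continuous fun z : H × H => z.2⁻¹ * z.1 * z.2 := by fun_prop
      exact h1.continuousAt.eventually_mem (by simpa using hV)
  obtain ⟨U, hU, hUN⟩ := exists_nhds_inv_mul_mem ι hι hD hN
  obtain ⟨k, hk, hks, hk0, hk1, hkU, hkδ⟩ :=
    hG.exists_density (hQ₂.image ι.continuous_toFun) hU hδ
  refine ⟨transfer ι k f χ, continuous_transfer ι hk hk0 hf hfs χ.continuous hχs hχ0 hfχ,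
    hasCompactSupport_transfer ι hks hfs, ?_⟩
  rintro ⟨s, t⟩ hst
  have hs : s ∈ Prod.fst '' Q := ⟨_, hst, rfl⟩
  have ht : t ∈ Prod.snd '' Q := ⟨_, hst, rfl⟩
  have h1 := norm_integral_translate_sub_le ι hk hks hk0 hk1 hf hfs χ.continuous hχs hχ0 hM0 hfχ
    s t (hkδ (ι t) ⟨t, ht, rfl⟩) hκ
  have h2 := norm_integral_transfer_sub_le ι hk hks hk0 hk1 hf hfs χ.continuous hχs hχ0 hfχ
    s t hη.le (D := D) (fun h hh => Or.inl (subset_tsupport _ hh))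
    (fun h hh => Or.inr ⟨s * (s⁻¹ * h * t), ⟨s, hs, _, subset_tsupport _ hh, rfl⟩, t⁻¹,
      Set.inv_mem_inv.2 ht, by group⟩)
    (fun h hh g hg x hx gx => by
      obtain ⟨n1, n2, n3⟩ := hUN h hh g hg x (hkU _ hx) (hkU _ gx)
      refine ⟨?_, fun hfh => ?_, fun hfh => ?_⟩
      · simpa using (n1 h hh).le
      · exact hχ1 ⟨h, subset_tsupport _ hfh, _, n2, by simp⟩
      · exact hχ1 ⟨_, subset_tsupport _ hfh, _, n3 t ht, by group⟩)
  have h3 : √(modularFunction t : ℝ) * (2 * η * ((modularFunction t : ℝ)⁻¹ * I)) ≤ ε / 4 := by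
    refine le_trans ?_ hηε
    have hCt := (le_abs_self _).trans ((hC t ht).trans (le_abs_self C))
    calc √(modularFunction t : ℝ) * (2 * η * ((modularFunction t : ℝ)⁻¹ * I))
        = √(modularFunction t : ℝ) * (modularFunction t : ℝ)⁻¹ * (2 * η * I) := by ring
      _ ≤ _ := mul_le_mul_of_nonneg_right hCt (by positivity)
  rw [norm_sub_rev]
  refine (norm_sub_le_norm_sub_add_norm_sub _ _ _).trans_lt
    (lt_of_le_of_lt (add_le_add h1 h2) ?_)
  linarith

end Approximation

/-! ### Coefficients as integrals, and passage to `L²(H)` -/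

section Coefficients

open ComplexConjugate

variable {G : Type*} [Group G] [TopologicalSpace G] [IsTopologicalGroup G] [LocallyCompactSpace G]
  [MeasurableSpace G] [BorelSpace G]

/-- The diagonal coefficients of `λ_G·ρ_G` as integrals. -/
lemma biregular_coeff_toLp {F : G → ℂ} (hF : MemLp F 2 (haar : Measure G)) (p : G × G) :
    (biregular G).coeff (hF.toLp F) (hF.toLp F) p
      = ∫ x, (√(modularFunction p.2 : ℝ) : ℂ) * F (p.1⁻¹ * x * p.2) * conj (F x)
        ∂(haar : Measure G) := by
  obtain ⟨s, t⟩ := p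
  change inner ℂ (hF.toLp F) (leftTranslation 2 s (rightTranslation 2 t (hF.toLp F))) = _
  rw [L2.inner_def]
  have h1 := (measurePreserving_mul_left (haar : Measure G) s⁻¹).quasiMeasurePreserving.ae_eq_comp
    (coeFn_rightTranslation 2 t (hF.toLp F))
  have h2 := (measurePreserving_mul_left (haar : Measure G) s⁻¹).quasiMeasurePreserving.ae_eq_comp
    ((quasiMeasurePreserving_mul_right_haar t).ae_eq_comp hF.coeFn_toLp)
  refine integral_congr_ae ?_
  filter_upwards [coeFn_leftTranslation 2 s (rightTranslation 2 t (hF.toLp F)), h1, h2,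
    hF.coeFn_toLp] with x a b c d
  simp only [Function.comp_apply] at b c
  rw [a, b, c, d, Real.sqrt_eq_rpow]
  simp

end Coefficients

end LCGroup

/-- The bound is independent of `s` by unitarity, so a vector may be replaced by a nearby one in a
dense subspace. -/
lemma UnitaryRep.norm_coeff_sub_le {G : Type*} [Group G] [TopologicalSpace G] {V : Type*}
    [NormedAddCommGroup V] [InnerProductSpace ℂ V] (π : UnitaryRep G V) (ξ η : V) (s : G) :
    ‖π.coeff ξ ξ s - π.coeff η η s‖ ≤ ‖ξ - η‖ * (‖ξ‖ + ‖η‖) := by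
  have e : π.coeff ξ ξ s - π.coeff η η s
      = inner ℂ ξ (π.toHom s (ξ - η)) + inner ℂ (ξ - η) (π.toHom s η) := by
    simp only [UnitaryRep.coeff, map_sub, inner_sub_left, inner_sub_right]
    ring
  rw [e]
  refine (norm_add_le _ _).trans ((add_le_add (norm_inner_le_norm _ _)
    (norm_inner_le_norm _ _)).trans_eq ?_)
  rw [LinearIsometryEquiv.norm_map, LinearIsometryEquiv.norm_map]
  ring

theorem mainTheorem2
    {G H : Type*}
    [Group G] [TopologicalSpace G] [IsTopologicalGroup G] [LocallyCompactSpace G] [T2Space G]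
    [MeasurableSpace G] [BorelSpace G]
    [Group H] [TopologicalSpace H] [IsTopologicalGroup H] [LocallyCompactSpace H] [T2Space H]
    [MeasurableSpace H] [BorelSpace H]
    (hG : LCGroup.IsQSIN G)
    (ι : H →ₜ* G) (hι : Function.Injective ι) :
    (LCGroup.biregular H).WeaklyContained ((LCGroup.biregular G).comp (ι.prodMap ι)) := by
  intro ξ Q hQ ε hε
  -- `r ≤ 1` bounds the norm of the approximant by `‖ξ‖ + 1`, so `2‖ξ‖ + 1` bounds the sum of norms
  -- in `norm_coeff_sub_le`.
  obtain ⟨r, hr, hr1, hrε⟩ : ∃ r > 0, r ≤ 1 ∧ r * (2 * ‖ξ‖ + 1) ≤ ε / 2 :=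
    ⟨min 1 (ε / (2 * (2 * ‖ξ‖ + 1))), by positivity, min_le_left _ _, by
      refine (mul_le_mul_of_nonneg_right (min_le_right _ _) (by positivity)).trans_eq ?_
      field_simp⟩
  obtain ⟨f, hξf, hf, hfm, hfs⟩ := LCGroup.exists_compactSupport_approx (p := 2) (by simp)
    (Lp.memLp ξ) (ε := ENNReal.ofReal r) (by simpa using hr)
  have hdist : ‖ξ - hfm.toLp f‖ ≤ r := by
    rw [Lp.norm_def, eLpNorm_congr_ae (g := (ξ : H → ℂ) - f)]
    · exact ENNReal.toReal_le_of_le_ofReal hr.le hξf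
    · filter_upwards [Lp.coeFn_sub ξ (hfm.toLp f), hfm.coeFn_toLp] with x a b
      rw [a, Pi.sub_apply, Pi.sub_apply, b]
  have hnorm : ‖hfm.toLp f‖ ≤ ‖ξ‖ + 1 := by
    have := norm_sub_norm_le (hfm.toLp f) ξ
    rw [norm_sub_rev] at this
    linarith
  obtain ⟨F, hF, hFs, hFQ⟩ := LCGroup.exists_coefficient_approx hG ι hι hf hfs hQ (half_pos hε)
  have hFm : MemLp F 2 (Measure.haar : Measure G) := hF.memLp_of_hasCompactSupport hFs
  refine ⟨1, fun _ => hFm.toLp F, fun p hp => ?_⟩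
  have h1 := (LCGroup.biregular H).norm_coeff_sub_le ξ (hfm.toLp f) p
  have h2 := hFQ p hp
  have h3 : ((LCGroup.biregular G).comp (ι.prodMap ι)).coeff (hFm.toLp F) (hFm.toLp F) p
      = (LCGroup.biregular G).coeff (hFm.toLp F) (hFm.toLp F) (ι p.1, ι p.2) := rfl
  rw [Fin.sum_univ_one, h3, LCGroup.biregular_coeff_toLp]
  rw [LCGroup.biregular_coeff_toLp] at h1
  refine (norm_sub_le_norm_sub_add_norm_sub _ _ _).trans_lt
    (lt_of_lt_of_le (add_lt_add_of_le_of_lt h1 h2) ?_)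
  have : ‖ξ - hfm.toLp f‖ * (‖ξ‖ + ‖hfm.toLp f‖) ≤ r * (2 * ‖ξ‖ + 1) :=
    mul_le_mul hdist (by linarith) (by positivity) hr.le
  linarith
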